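/- **Setting.** A homotopy data triple $(\alpha,\tau,S)$ consists of a finite set $\alpha$, an involution $\tau$ on $\alpha$ (that is, $\tau\circ\tau=\mathrm{id}$) and a subset $S\subseteq\alpha\times\alpha\times\alpha$. If $\beta\subseteq\alpha$ is $\tau$-invariant, put $\tau_\beta=\tau|_\beta$ and $S_\beta=S\cap(\beta\times\beta\times\beta)$; with $\gamma=\alpha\setminus\beta$, the triple $(\beta,\tau_\beta,S_\beta)$ is a *factor* of $(\alpha,\tau,S)$ if $S=S_\beta\cup S_\gamma$, and it is a *proper factor* if moreover $\emptyset\neq\beta\neq\alpha$. A triple is *composite* if it has a proper factor, and *prime* if its underlying set is non-empty and it has no proper factor. The prime factors of a triple are its factors that are prime. For a non-empty set $\alpha$, an $n$-component *nanophrase* over $\alpha$ ($n\ge 0$) is a pair $(\mathcal A,p)$, where $\mathcal A$ is a finite set of letters with a map $\mathcal A\to\alpha$, $X\mapsto|X|$, and $p=w_1|w_2|\dotsb|w_n$ is a sequence of $n$ (possibly empty) words on $\mathcal A$ in which every letter of $\mathcal A$ occurs exactly twice in total. Two nanophrases are isomorphic if a bijection of their alphabets compatible with the maps to $\alpha$ carries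 one phrase to the other component by component. *Homotopy* $\sim$ given by $(\alpha,\tau,S)$ is the equivalence relation on nanophrases over $\alpha$ generated by isomorphisms and the moves - H1: $(\mathcal A,xAAy)\longleftrightarrow(\mathcal A\setminus\{A\},xy)$; - H2: $(\mathcal A,xAByBAz)\longleftrightarrow(\mathcal A\setminus\{A,B\},xyz)$ if $\tau(|A|)=|B|$; - H3: $(\mathcal A,xAByACzBCt)\longleftrightarrow(\mathcal A,xBAyCAzCBt)$ if $(|A|,|B|,|C|)\in S$; where $x,y,z,t$ are arbitrary sequences of letters, possibly including bars $|$, such that both sides are nanophrases; the number of components is unchanged. A nanophrase $p$ is *$i$-reducible* if it is homotopic to a nanophrase whose $i$th component exists and is empty. The homotopy given by $(\alpha,\tau,S)$ is *reduction decidable* if there is an algorithm which, given any nanophrase $p$ over $\alpha$ and any $i$, decides in finite time whether $p$ is $i$-reducible. It is *equality decidable* if there is an algorithm which, given any two nanophrases $p,q$ over $\alpha$, decides in finite time whether $p\sim q$. **Theorem.** Let $(\alpha,\tau,S)$ be a composite homotopy data triple with $\alpha$ finite. Suppose that for each prime factor of $(\alpha,\tau,S)$ the homotopy of nanophrases given by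 that factor is both reduction decidable and equality decidable. Then the homotopy of nanophrases given by $(\alpha,\tau,S)$ is also reduction decidable and equality decidable. -/

import Mathlib

/-- A letter of an `α`-alphabet: a name together with its projection to `α`.  A finite set of
such letters, with the second coordinate as projection, is an `α`-alphabet, and every
`α`-alphabet is isomorphic to one of this form. -/
abbrev Letter (α : Type*) := ℕ × α

open Classical in
/-- A nanophrase over `α`: a finite sequence of words in which every letter that occurs,
occurs exactly twice in the whole phrase.  Its alphabet is the set of letters that occur.
There is one nanophrase with no component, and it differs from the nanophrase with one
empty component. -/
structure Nanophrase (α : Type*) where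
  components : List (List (Letter α))
  gauss : ∀ X ∈ components.flatten, components.flatten.count X = 2

namespace Nanophrase

variable {α : Type*}

/-- The alphabet of a nanophrase. -/
def alphabet (p : Nanophrase α) : Set (Letter α) := {X | X ∈ p.components.flatten}

/-- The number of components. -/
def nc (p : Nanophrase α) : ℕ := p.components.length

/-- The nanophrase written as a single sequence: `some X` is the letter `X` and `none` is the
bar that separates two consecutive components.  Together with the number of components it
determines the phrase. -/
def written (p : Nanophrase α) : List (Option (Letter α)) :=
  List.intercalate [none] (p.components.map (List.map some))

/-- Isomorphism: a projection-preserving bijection of the alphabets which, applied letterwise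
to each component of `p`, gives the corresponding component of `q`. -/
def Isomorphic (p q : Nanophrase α) : Prop :=
  ∃ f : Letter α → Letter α, Set.BijOn f p.alphabet q.alphabet ∧
    (∀ X ∈ p.alphabet, (f X).2 = X.2) ∧
    q.components = p.components.map (List.map f)

/-- The code of a nanophrase, for a given numbering of `α`, on which algorithms operate: each
letter is given by its name and the number of its projection. -/
def code {n : ℕ} (e : α ≃ Fin n) (p : Nanophrase α) : List (List (ℕ × ℕ)) :=
  p.components.map (List.map fun X => (X.1, (e X.2 : ℕ)))

end Nanophrase

/-- A homotopy data triple `(α, τ, S)`. -/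
structure HomotopyDataTriple (α : Type*) where
  τ : α → α
  involutive : Function.Involutive τ
  S : Set (α × α × α)

namespace HomotopyDataTriple

variable {α : Type*} (H : HomotopyDataTriple α)

/-- `xAAy ⟶ xy`, where `x`, `y` may contain bars. -/
def MoveH1 (p q : Nanophrase α) : Prop :=
  p.nc = q.nc ∧ ∃ (A : Letter α) (x y : List (Option (Letter α))),
    p.written = x ++ [some A, some A] ++ y ∧
    q.written = x ++ y

/-- `xAByBAz ⟶ xyz` if `τ |A| = |B|`, where `x`, `y`, `z` may contain bars. -/
def MoveH2 (p q : Nanophrase α) : Prop :=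
  p.nc = q.nc ∧ ∃ (A B : Letter α) (x y z : List (Option (Letter α))),
    H.τ A.2 = B.2 ∧
    p.written = x ++ [some A, some B] ++ y ++ [some B, some A] ++ z ∧
    q.written = x ++ y ++ z

/-- `xAByACzBCt ⟶ xBAyCAzCBt` if `(|A|, |B|, |C|) ∈ S`, where `x`, `y`, `z`, `t` may contain
bars. -/
def MoveH3 (p q : Nanophrase α) : Prop :=
  p.nc = q.nc ∧ ∃ (A B C : Letter α) (x y z t : List (Option (Letter α))),
    (A.2, B.2, C.2) ∈ H.S ∧
    p.written = x ++ [some A, some B] ++ y ++ [some A, some C] ++ z ++ [some B, some C] ++ t ∧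
    q.written = x ++ [some B, some A] ++ y ++ [some C, some A] ++ z ++ [some C, some B] ++ t

/-- Homotopy of nanophrases: the equivalence relation generated by isomorphisms and the
homotopy moves. -/
def Homotopic : Nanophrase α → Nanophrase α → Prop :=
  Relation.EqvGen fun p q =>
    p.Isomorphic q ∨ MoveH1 p q ∨ H.MoveH2 p q ∨ H.MoveH3 p q

/-- `p` is homotopic to a nanophrase whose component at position `i` (counted from `0`) exists
and is empty.  This is false if `p` has no component at position `i`. -/
def IsReducibleAt (p : Nanophrase α) (i : ℕ) : Prop :=
  ∃ q : Nanophrase α, H.Homotopic p q ∧ q.components[i]? = some []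

/-- There is an algorithm which decides for any nanophrase `p` and any `i` whether `p` is
reducible at position `i`.  The choice of the numbering `e` of the finite set `α` is
immaterial, as is the answer on inputs that are not codes of nanophrases. -/
def ReductionDecidable : Prop :=
  ∃ (n : ℕ) (e : α ≃ Fin n) (f : List (List (ℕ × ℕ)) × ℕ → Bool), Computable f ∧
    ∀ (p : Nanophrase α) (i : ℕ), f (p.code e, i) = true ↔ H.IsReducibleAt p i

/-- There is an algorithm which decides for any two nanophrases whether they are homotopic. -/
def EqualityDecidable : Prop :=
  ∃ (n : ℕ) (e : α ≃ Fin n) (f : List (List (ℕ × ℕ)) × List (List (ℕ × ℕ)) → Bool),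
    Computable f ∧
    ∀ p q : Nanophrase α, f (p.code e, q.code e) = true ↔ H.Homotopic p q

/-- The triple `(β, τ_β, S_β)` for a `τ`-invariant subset `β` of `α`. -/
def restrict (β : Set α) (hβ : Set.MapsTo H.τ β β) : HomotopyDataTriple β where
  τ := hβ.restrict H.τ β β
  involutive := fun a => Subtype.ext (H.involutive a)
  S := {t | ((t.1 : α), (t.2.1 : α), (t.2.2 : α)) ∈ H.S}

/-- `β` is `τ`-invariant and every element of `S` lies in `β × β × β` or in `γ × γ × γ`, where
`γ` is the complement of `β`; that is, `(β, τ_β, S_β)` is a factor of `(α, τ, S)`. -/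
structure IsFactor (β : Set α) : Prop where
  mapsTo : Set.MapsTo H.τ β β
  S_eq : H.S = (H.S ∩ β ×ˢ β ×ˢ β) ∪ (H.S ∩ βᶜ ×ˢ βᶜ ×ˢ βᶜ)

/-- A proper factor: `β` is a non-empty proper subset of `α`. -/
def IsProperFactor (β : Set α) : Prop :=
  H.IsFactor β ∧ β.Nonempty ∧ β ≠ Set.univ

/-- The triple has a proper factor. -/
def IsComposite : Prop := ∃ β : Set α, H.IsProperFactor β

/-- `α` is non-empty and the triple has no proper factor. -/
def IsPrime : Prop := Nonempty α ∧ ¬ ∃ β : Set α, H.IsProperFactor β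

end HomotopyDataTriple

/-! Split `α` into two complementary factors and give each letter the colour of the factor that
contains its projection. No homotopy move involves two colours, but the projections of a phrase to
the two factors lose the way in which letters of different colours interleave. Extra bars record it.
A tagged phrase has a tag on each component: `0` if the bar before it is an original one, a colour
if that bar is soft, that is, inserted. `refine` makes every letter a component of its own. A soft
bar may be removed if the components on its two sides have the same tag, or if the component after
it is reducible; `Rewrites` consists of these removals and of homotopy with all bars and tags fixed.

Three facts carry the proof. By `phraseHomotopic_iff_eqvGen`, two phrases are homotopic exactly if
their refinements are equivalent under rewriting: the letters of a move have one colour, so their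
components can be joined before the move, and conversely forgetting the soft bars turns rewriting
into homotopy. By `Rewrites.diamond`, rewriting is confluent, so equivalent normal tagged phrases
have equal tags and homotopic underlying phrases (`IsNormal.eq_of_eqvGen`). By
`phraseHomotopic_iff_of_pure`, if all components are monochromatic, with the same tags in both
phrases, homotopy can be tested in the two factors separately.

Reducibility is a case of homotopy: deleting all letters that occur in a given component respects
homotopy, so a phrase is reducible there exactly if it is homotopic to the result of this deletion
(`isReducibleAt_iff`). An algorithm can therefore start from the refinement, remove soft bars while
possible, staying among pure phrases where homotopy is decidable, and finally compare normal forms.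
Induction on the size of a factor reaches the prime factors, and reduction decidability follows from
equality decidability. -/

/-- A finite sequence of words in the letters of `α`. -/
abbrev Phrase (α : Type*) := List (List (Letter α))

/-! ### Phrases as sequences of letters and bars -/

namespace Phrase

section Tokens

variable {β γ : Type*}

/-- The phrase as a single sequence in which every component is preceded by a bar `none`. -/
def lead : List (List β) → List (Option β)
  | [] => []
  | w :: l => none :: (w.map some ++ lead l)

/-- The number of bars. -/
def bars : List (Option β) → ℕ
  | [] => 0
  | none :: T => bars T + 1
  | some _ :: T => bars T

/-- The letters of a sequence of letters and bars. -/
def letters : List (Option β) → List β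
  | [] => []
  | none :: T => letters T
  | some X :: T => X :: letters T

/-- The letters before the first bar, and the components after it. -/
def parse : List (Option β) → List β × List (List β)
  | [] => ([], [])
  | none :: T => ([], (parse T).1 :: (parse T).2)
  | some X :: T => (X :: (parse T).1, (parse T).2)

/-- Replace the `k`th bar by `b k` and delete or rename letters according to `g`. -/
def process (b : ℕ → List (Option γ)) (g : β → Option γ) : ℕ → List (Option β) → List (Option γ)
  | _, [] => []
  | k, none :: T => b k ++ process b g (k + 1) T
  | k, some X :: T => ((g X).map some).toList ++ process b g k T

@[simp] theorem bars_append (x y : List (Option β)) : bars (x ++ y) = bars x + bars y := by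
  induction x with
  | nil => simp [bars]
  | cons a x ih => cases a <;> simp [bars, ih]; omega

@[simp] theorem letters_append (x y : List (Option β)) :
    letters (x ++ y) = letters x ++ letters y := by
  induction x with
  | nil => simp [letters]
  | cons a x ih => cases a <;> simp [letters, ih]

@[simp] theorem letters_map_some (w : List β) : letters (w.map some) = w := by
  induction w with
  | nil => simp [letters]
  | cons a x ih => simp [letters, ih]

@[simp] theorem bars_map_some (w : List β) : bars (w.map some) = 0 := by
  induction w with
  | nil => simp [bars]
  | cons a x ih => simp [bars, ih]

@[simp] theorem letters_lead (l : List (List β)) : letters (lead l) = l.flatten := by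
  induction l with
  | nil => simp [lead, letters]
  | cons w l ih => simp [lead, letters, ih]

@[simp] theorem bars_lead (l : List (List β)) : bars (lead l) = l.length := by
  induction l with
  | nil => simp [lead, bars]
  | cons w l ih => simp [lead, bars, ih]

theorem parse_map_some_append (w : List β) (T : List (Option β)) :
    parse (w.map some ++ T) = (w ++ (parse T).1, (parse T).2) := by
  induction w with
  | nil => simp
  | cons a w ih => simp [parse, ih]

theorem parse_lead (l : List (List β)) : parse (lead l) = ([], l) := by
  induction l with
  | nil => simp [lead, parse]
  | cons w l ih => simp [lead, parse, parse_map_some_append, ih]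

theorem lead_injective : Function.Injective (lead : List (List β) → _) := fun l l' h => by
  simpa [parse_lead] using congrArg (fun T => (parse T).2) h

theorem map_some_parse_append_lead (T : List (Option β)) :
    (parse T).1.map some ++ lead (parse T).2 = T := by
  induction T with
  | nil => simp [lead, parse]
  | cons a T ih => cases a <;> simp [lead, parse, ih]

/-- The phrase is empty or begins with a bar. -/
def BeginsWithBar (T : List (Option β)) : Prop := (parse T).1 = []

theorem lead_parse {T : List (Option β)} (h : BeginsWithBar T) : lead (parse T).2 = T := by
  have := map_some_parse_append_lead T
  rw [h] at this
  simpa using this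

/-- The phrase without components and the phrase with one empty component have the same `written`
form; the leading bar tells them apart. This is why `lead` is injective and needs no separate count
of components. -/
theorem lead_eq_cons_written {α : Type*} (p : Nanophrase α) (h : p.components ≠ []) :
    lead p.components = none :: p.written := by
  unfold Nanophrase.written
  generalize p.components = l at h
  induction l with
  | nil => exact absurd rfl h
  | cons w l ih =>
    cases l with
    | nil => simp [lead, List.intercalate]
    | cons v l =>
      rw [lead, ih (by simp)]
      simp [List.intercalate]

@[simp] theorem process_append (b : ℕ → List (Option γ)) (g : β → Option γ) (k : ℕ)
    (x y : List (Option β)) :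
    process b g k (x ++ y) = process b g k x ++ process b g (k + bars x) y := by
  induction x generalizing k with
  | nil => simp [process, bars]
  | cons a x ih =>
    cases a with
    | none => simp [process, bars, ih, Nat.add_assoc, Nat.add_comm 1]
    | some X => simp [process, bars, ih]

theorem process_congr {b : ℕ → List (Option γ)} {g g' : β → Option γ} (k : ℕ)
    {T : List (Option β)} (h : ∀ X ∈ letters T, g X = g' X) :
    process b g k T = process b g' k T := by
  induction T generalizing k with
  | nil => rfl
  | cons a T ih =>
    cases a with
    | none => simp only [process, ih _ h]
    | some X =>
      simp only [letters, List.mem_cons, forall_eq_or_imp] at h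
      simp only [process, ih _ h.2, h.1]

theorem process_map_some (b : ℕ → List (Option γ)) (g : β → Option γ) (k : ℕ) (w : List β) :
    process b g k (w.map some) = (w.filterMap g).map some := by
  induction w with
  | nil => simp [process]
  | cons a w ih => cases h : g a <;> simp [process, ih, h]

end Tokens

open Classical in
/-- Every letter that occurs, occurs exactly twice. -/
def Gauss {α : Type*} (l : Phrase α) : Prop := ∀ X ∈ l.flatten, l.flatten.count X = 2

open Classical in
theorem Gauss.of_perm {α : Type*} {l l' : Phrase α} (h : l.flatten.Perm l'.flatten) :
    Gauss l ↔ Gauss l' := by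
  simp only [Gauss, h.mem_iff, h.count_eq]

end Phrase

/-! ### Moves on sequences, and homotopy of phrases -/

namespace HomotopyDataTriple

open Phrase

variable {α α' : Type*} (H : HomotopyDataTriple α) (H' : HomotopyDataTriple α')

/-- The homotopy moves on sequences of letters and bars. -/
inductive TokenMove : List (Option (Letter α)) → List (Option (Letter α)) → Prop
  | h1 (A : Letter α) (x y : List (Option (Letter α))) :
    TokenMove (x ++ [some A, some A] ++ y) (x ++ y)
  | h2 (A B : Letter α) (x y z : List (Option (Letter α))) (h : H.τ A.2 = B.2) :
    TokenMove (x ++ [some A, some B] ++ y ++ [some B, some A] ++ z) (x ++ y ++ z)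
  | h3 (A B C : Letter α) (x y z t : List (Option (Letter α))) (h : (A.2, B.2, C.2) ∈ H.S) :
    TokenMove (x ++ [some A, some B] ++ y ++ [some A, some C] ++ z ++ [some B, some C] ++ t)
      (x ++ [some B, some A] ++ y ++ [some C, some A] ++ z ++ [some C, some B] ++ t)

variable {H H'}

theorem TokenMove.bars_eq {T T' : List (Option (Letter α))} (h : H.TokenMove T T') :
    bars T = bars T' := by
  cases h <;> simp [bars]

theorem TokenMove.cons {T T' : List (Option (Letter α))} (h : H.TokenMove T T')
    (a : Option (Letter α)) : H.TokenMove (a :: T) (a :: T') := by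
  cases h with
  | h1 A x y => exact .h1 A (a :: x) y
  | h2 A B x y z h => exact .h2 A B (a :: x) y z h
  | h3 A B C x y z t h => exact .h3 A B C (a :: x) y z t h

/-- The part changed by a move begins with a letter, so a leading bar belongs to the unchanged
prefix `x`. -/
theorem TokenMove.of_cons_none {T T' : List (Option (Letter α))}
    (h : H.TokenMove (none :: T) (none :: T')) : H.TokenMove T T' := by
  generalize hU : none :: T = U at h
  generalize hU' : none :: T' = U' at h
  cases h with
  | h1 A x y =>
    cases x with
    | nil => simp at hU
    | cons a x =>
      simp only [List.cons_append, List.cons.injEq] at hU hU'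
      rw [hU.2, hU'.2]; exact .h1 A x y
  | h2 A B x y z h =>
    cases x with
    | nil => simp at hU
    | cons a x =>
      simp only [List.cons_append, List.cons.injEq] at hU hU'
      rw [hU.2, hU'.2]; exact .h2 A B x y z h
  | h3 A B C x y z t h =>
    cases x with
    | nil => simp at hU
    | cons a x =>
      simp only [List.cons_append, List.cons.injEq] at hU hU'
      rw [hU.2, hU'.2]; exact .h3 A B C x y z t h

theorem tokenMove_written_iff {p q : Nanophrase α} :
    p.nc = q.nc ∧ H.TokenMove p.written q.written ↔ MoveH1 p q ∨ H.MoveH2 p q ∨ H.MoveH3 p q := by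
  constructor
  · rintro ⟨hn, h⟩
    generalize hU : p.written = U at h
    generalize hU' : q.written = U' at h
    cases h with
    | h1 A x y => exact .inl ⟨hn, A, x, y, hU, hU'⟩
    | h2 A B x y z h => exact .inr (.inl ⟨hn, A, B, x, y, z, h, hU, hU'⟩)
    | h3 A B C x y z t h => exact .inr (.inr ⟨hn, A, B, C, x, y, z, t, h, hU, hU'⟩)
  · rintro (⟨hn, A, x, y, hp, hq⟩ | ⟨hn, A, B, x, y, z, h, hp, hq⟩ |
      ⟨hn, A, B, C, x, y, z, t, h, hp, hq⟩)
    · rw [hp, hq]; exact ⟨hn, .h1 A x y⟩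
    · rw [hp, hq]; exact ⟨hn, .h2 A B x y z h⟩
    · rw [hp, hq]; exact ⟨hn, .h3 A B C x y z t h⟩

theorem TokenMove.ne_nil {T T' : List (Option (Letter α))} (h : H.TokenMove T T') : T ≠ [] := by
  cases h <;> simp

theorem tokenMove_lead_iff {p q : Nanophrase α} :
    H.TokenMove (lead p.components) (lead q.components) ↔
      MoveH1 p q ∨ H.MoveH2 p q ∨ H.MoveH3 p q := by
  rw [← tokenMove_written_iff]
  constructor
  · intro h
    have hn : p.nc = q.nc := by simpa [Nanophrase.nc] using h.bars_eq
    have hp : p.components ≠ [] := fun h0 => h.ne_nil (by simp [h0, lead])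
    have hq : q.components ≠ [] := fun h0 => hp (by simpa [Nanophrase.nc, h0] using hn)
    rw [lead_eq_cons_written p hp, lead_eq_cons_written q hq] at h
    exact ⟨hn, h.of_cons_none⟩
  · rintro ⟨hn, h⟩
    have hp : p.components ≠ [] := fun h0 => h.ne_nil (by
      simp [Nanophrase.written, h0, List.intercalate])
    have hq : q.components ≠ [] := fun h0 => hp (by simpa [Nanophrase.nc, h0] using hn)
    rw [lead_eq_cons_written p hp, lead_eq_cons_written q hq]
    exact h.cons none

variable (H) in
/-- Both phrases are Gauss phrases, and as nanophrases they are homotopic. -/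
def PhraseHomotopic (l l' : Phrase α) : Prop :=
  ∃ (hl : Gauss l) (hl' : Gauss l'), H.Homotopic ⟨l, hl⟩ ⟨l', hl'⟩

namespace PhraseHomotopic

theorem refl {l : Phrase α} (h : Gauss l) : H.PhraseHomotopic l l := ⟨h, h, .refl _⟩

theorem symm {l l' : Phrase α} (h : H.PhraseHomotopic l l') : H.PhraseHomotopic l' l :=
  let ⟨h1, h2, h⟩ := h; ⟨h2, h1, .symm _ _ h⟩

theorem trans {l l' l'' : Phrase α} (h : H.PhraseHomotopic l l') (h' : H.PhraseHomotopic l' l'') :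
    H.PhraseHomotopic l l'' :=
  let ⟨h1, _, h⟩ := h; let ⟨_, h3, h'⟩ := h'; ⟨h1, h3, .trans _ _ _ h h'⟩

theorem gauss_left {l l' : Phrase α} (h : H.PhraseHomotopic l l') : Gauss l := h.1

theorem gauss_right {l l' : Phrase α} (h : H.PhraseHomotopic l l') : Gauss l' := h.2.1

theorem of_move {l l' : Phrase α} (hl : Gauss l) (hl' : Gauss l')
    (h : H.TokenMove (lead l) (lead l')) : H.PhraseHomotopic l l' :=
  ⟨hl, hl', .rel _ _ (.inr (tokenMove_lead_iff.1 h))⟩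

theorem of_eq_or_move {l l' : Phrase α} (hl : Gauss l) (hl' : Gauss l')
    (h : lead l = lead l' ∨ H.TokenMove (lead l) (lead l')) : H.PhraseHomotopic l l' := by
  rcases h with h | h
  · rw [lead_injective h]; exact .refl hl'
  · exact .of_move hl hl' h

end PhraseHomotopic

theorem _root_.Nanophrase.phraseHomotopic_iff {p q : Nanophrase α} :
    H.PhraseHomotopic p.components q.components ↔ H.Homotopic p q :=
  ⟨fun ⟨_, _, h⟩ => h, fun h => ⟨p.gauss, q.gauss, h⟩⟩

/-- `f` is a projection preserving injection on the letters of `l`. -/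
structure IsRenaming (f : Letter α → Letter α) (l : Phrase α) : Prop where
  inj : Set.InjOn f {X | X ∈ l.flatten}
  proj : ∀ X ∈ l.flatten, (f X).2 = X.2

theorem PhraseHomotopic.of_renaming {f : Letter α → Letter α} {l : Phrase α} (hl : Gauss l)
    (hl' : Gauss (l.map (List.map f))) (hf : IsRenaming f l) :
    H.PhraseHomotopic l (l.map (List.map f)) := by
  refine ⟨hl, hl', .rel _ _ (.inl ⟨f, ⟨?_, hf.inj, ?_⟩, hf.proj, rfl⟩)⟩
  · intro X hX
    simp only [Nanophrase.alphabet, Set.mem_ofPred_eq, ← List.map_flatten] at hX ⊢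
    exact List.mem_map_of_mem hX
  · intro X hX
    simpa [Nanophrase.alphabet, ← List.map_flatten] using hX

/-- The common scheme for all invariance results: an operation on phrases respects homotopy once it
respects renamings and single moves. -/
theorem PhraseHomotopic.map {op : Phrase α → Phrase α'}
    (hop : ∀ l, Gauss l → Gauss (op l))
    (hren : ∀ f l, Gauss l → Gauss (l.map (List.map f)) → IsRenaming f l →
      H'.PhraseHomotopic (op l) (op (l.map (List.map f))))
    (hmove : ∀ l l', Gauss l → Gauss l' → H.TokenMove (lead l) (lead l') →
      H'.PhraseHomotopic (op l) (op l')) {l l' : Phrase α} (h : H.PhraseHomotopic l l') :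
    H'.PhraseHomotopic (op l) (op l') := by
  obtain ⟨hl, hl', h⟩ := h
  suffices ∀ p q : Nanophrase α, H.Homotopic p q →
      H'.PhraseHomotopic (op p.components) (op q.components) from this _ _ h
  intro p q h
  induction h with
  | rel p q h =>
    rcases h with ⟨f, hf, hproj, hq⟩ | h
    · have := q.gauss
      rw [hq] at this ⊢
      exact hren f _ p.gauss this ⟨hf.injOn, hproj⟩
    · exact hmove _ _ p.gauss q.gauss (tokenMove_lead_iff.2 h)
  | refl p => exact .refl (hop _ p.gauss)
  | symm p q _ ih => exact ih.symm
  | trans p q r _ _ ih ih' => exact ih.trans ih'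

theorem PhraseHomotopic.length_eq {l l' : Phrase α} (h : H.PhraseHomotopic l l') :
    l.length = l'.length := by
  obtain ⟨hl, hl', h⟩ := h
  suffices ∀ p q : Nanophrase α, H.Homotopic p q →
      p.components.length = q.components.length from this _ _ h
  intro p q h
  induction h with
  | rel p q h =>
    rcases h with ⟨f, hf, hproj, hq⟩ | h
    · simp [hq]
    · simpa using (tokenMove_lead_iff.2 h).bars_eq
  | refl p => rfl
  | symm p q _ ih => exact ih.symm
  | trans p q r _ _ ih ih' => exact ih.trans ih'

/-- Adjacent letters stay adjacent when other letters are deleted and bars are replaced. A move thus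
survives if all its letters are kept, and becomes trivial if H1 or H2 loses all its letters. In H3
it is enough that two of the three letters disappear, since each of the three exchanged pairs then
has at most one letter left. -/
theorem TokenMove.process {b : ℕ → List (Option (Letter α'))} {g : Letter α → Option (Letter α')}
    (k : ℕ) {T T' : List (Option (Letter α))} (h : H.TokenMove T T')
    (h2 : ∀ A B x y z, T = x ++ [some A, some B] ++ y ++ [some B, some A] ++ z →
      H.τ A.2 = B.2 → (g A = none ∧ g B = none) ∨
        ∃ A' B', g A = some A' ∧ g B = some B' ∧ H'.τ A'.2 = B'.2)
    (h3 : ∀ A B C x y z t,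
      T = x ++ [some A, some B] ++ y ++ [some A, some C] ++ z ++ [some B, some C] ++ t →
      (A.2, B.2, C.2) ∈ H.S → (g A = none ∧ g B = none) ∨ (g A = none ∧ g C = none) ∨
        (g B = none ∧ g C = none) ∨ ∃ A' B' C', g A = some A' ∧ g B = some B' ∧ g C = some C' ∧
          (A'.2, B'.2, C'.2) ∈ H'.S) :
    Phrase.process b g k T = Phrase.process b g k T' ∨
      H'.TokenMove (Phrase.process b g k T) (Phrase.process b g k T') := by
  cases h with
  | h1 A x y =>
    cases hA : g A with
    | none => left; simp [Phrase.process, hA]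
    | some A' =>
      right
      simpa [Phrase.process, bars, hA] using TokenMove.h1 A' (H := H') (Phrase.process b g k x)
        (Phrase.process b g (k + bars x) y)
  | h2 A B x y z h =>
    rcases h2 A B x y z rfl h with ⟨hA, hB⟩ | ⟨A', B', hA, hB, h'⟩
    · left; simp [Phrase.process, hA, hB]
    · right
      simpa [Phrase.process, bars, hA, hB, Nat.add_assoc] using
        TokenMove.h2 A' B' (H := H') (Phrase.process b g k x)
        (Phrase.process b g (k + bars x) y) (Phrase.process b g (k + bars x + bars y) z) h'
  | h3 A B C x y z t h =>
    rcases h3 A B C x y z t rfl h with ⟨hA, hB⟩ | ⟨hA, hB⟩ | ⟨hA, hB⟩ | ⟨A', B', C', hA, hB, hC, h'⟩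
    · left; simp [Phrase.process, hA, hB]
    · left; simp [Phrase.process, hA, hB]
    · left; simp [Phrase.process, hA, hB]
    · right
      simpa [Phrase.process, bars, hA, hB, hC, Nat.add_assoc] using
        TokenMove.h3 A' B' C' (H := H') (Phrase.process b g k x)
        (Phrase.process b g (k + bars x) y) (Phrase.process b g (k + bars x + bars y) z)
        (Phrase.process b g (k + bars x + bars y + bars z) t) h'

end HomotopyDataTriple

/-! ### Joining components, erasing letters and projecting -/

namespace Phrase

section Lists

variable {β γ : Type*}

/-- Join the components at positions `i` and `i + 1`. -/
def mergeAt : ℕ → List (List β) → List (List β)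
  | 0, u :: v :: l => (u ++ v) :: l
  | 0, [u] => [u]
  | _, [] => []
  | i + 1, u :: l => u :: mergeAt i l

/-- Remove the bars whose numbers, counted from `k`, satisfy `s`; the first entry of the result
collects the letters before the first bar that is kept. -/
def removeBars (s : ℕ → Bool) : ℕ → List (List β) → List β × List (List β)
  | _, [] => ([], [])
  | k, u :: l =>
    if s k then (u ++ (removeBars s (k + 1) l).1, (removeBars s (k + 1) l).2)
    else ([], (u ++ (removeBars s (k + 1) l).1) :: (removeBars s (k + 1) l).2)

theorem lead_removeBars (s : ℕ → Bool) (k : ℕ) (l : List (List β)) :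
    (removeBars s k l).1.map some ++ lead (removeBars s k l).2 =
      process (fun j => if s j then [] else [none]) some k (lead l) := by
  induction l generalizing k with
  | nil => simp [removeBars, lead, process]
  | cons u l ih =>
    have := ih (k + 1)
    by_cases h : s k <;>
      simp [removeBars, h, lead, process, process_map_some, ← this]

theorem removeBars_fst {s : ℕ → Bool} {k : ℕ} (h : s k = false) (l : List (List β)) :
    (removeBars s k l).1 = [] := by
  cases l <;> simp [removeBars, h]

theorem lead_removeBars_snd {s : ℕ → Bool} {k : ℕ} (h : s k = false) (l : List (List β)) :
    lead (removeBars s k l).2 = process (fun j => if s j then [] else [none]) some k (lead l) := by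
  rw [← lead_removeBars, removeBars_fst h]; simp

theorem flatten_removeBars (s : ℕ → Bool) (k : ℕ) (l : List (List β)) :
    (removeBars s k l).1 ++ (removeBars s k l).2.flatten = l.flatten := by
  induction l generalizing k with
  | nil => simp [removeBars]
  | cons u l ih =>
    by_cases h : s k <;> simp [removeBars, h, ih]

theorem flatten_removeBars_snd {s : ℕ → Bool} {k : ℕ} (h : s k = false) (l : List (List β)) :
    (removeBars s k l).2.flatten = l.flatten := by
  simpa [removeBars_fst h] using flatten_removeBars s k l

theorem removeBars_map (f : β → γ) (s : ℕ → Bool) (k : ℕ) (l : List (List β)) :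
    removeBars s k (l.map (List.map f)) =
      ((removeBars s k l).1.map f, (removeBars s k l).2.map (List.map f)) := by
  induction l generalizing k with
  | nil => simp [removeBars]
  | cons u l ih =>
    by_cases h : s k <;> simp [removeBars, h, ih]

theorem removeBars_of_forall {s : ℕ → Bool} {k : ℕ} (h : ∀ j, k ≤ j → s j = false)
    (l : List (List β)) : removeBars s k l = ([], l) := by
  induction l generalizing k with
  | nil => simp [removeBars]
  | cons u l ih =>
    simp [removeBars, h k le_rfl, ih (k := k + 1) fun j hj => h j (by omega)]

/-- With numbering from `k`, component `i` is preceded by bar `k + i`, so the bar between components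
`i` and `i + 1` has number `k + i + 1`. Invariance of joining thereby follows from that of removing
bars. -/
theorem mergeAt_eq_removeBars (i k : ℕ) (l : List (List β)) :
    ([], mergeAt i l) = removeBars (fun j => decide (j = k + i + 1)) k l := by
  induction l generalizing i k with
  | nil => cases i <;> simp [mergeAt, removeBars]
  | cons u l ih =>
    cases i with
    | zero =>
      cases l with
      | nil => simp [mergeAt, removeBars]
      | cons v l =>
        simp [mergeAt, removeBars]
        rw [removeBars_of_forall]
        · simp
        · intro j hj; simp; omega
    | succ i =>
      have := ih i (k + 1)
      rw [show k + 1 + i + 1 = k + (i + 1) + 1 by omega] at this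
      have hk : k ≠ k + (i + 1) + 1 := by omega
      simp [mergeAt, removeBars, ← this, hk]

end Lists

theorem flatten_mergeAt {β : Type*} (i : ℕ) (l : List (List β)) :
    (mergeAt i l).flatten = l.flatten := by
  have := mergeAt_eq_removeBars i 0 l
  rw [show mergeAt i l = _ from congrArg Prod.snd this]
  exact flatten_removeBars_snd (by simp) l

open Classical in
/-- Delete all letters that occur in the component at position `i`. -/
noncomputable def eraseAt {α : Type*} (i : ℕ) (l : Phrase α) : Phrase α :=
  l.map (List.filter fun X => X ∉ l.getD i [])

/-- The letter of the alphabet over `α'` which `ι` sends to a given letter, if there is one. -/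
noncomputable def back {α α' : Type*} (ι : α' → α) (X : Letter α) : Option (Letter α') :=
  open Classical in if h : ∃ a, ι a = X.2 then some (X.1, h.choose) else none

/-- Change the projection of a letter by `ι`. -/
def fwd {α α' : Type*} (ι : α' → α) (X : Letter α') : Letter α := (X.1, ι X.2)

/-- Delete all letters whose projections are not in the range of `ι`. -/
noncomputable def proj {α α' : Type*} (ι : α' → α) (l : Phrase α) : Phrase α' :=
  l.map (List.filterMap (back ι))

section

variable {α α' : Type*} {ι : α' → α}

theorem back_eq_none {X : Letter α} : back ι X = none ↔ X.2 ∉ Set.range ι := by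
  unfold back; split_ifs with h <;> simp_all

theorem back_eq_some (hι : Function.Injective ι) {X : Letter α} {Y : Letter α'} :
    back ι X = some Y ↔ X = fwd ι Y := by
  unfold back fwd
  split_ifs with h
  · obtain ⟨n, a⟩ := X
    obtain ⟨m, b⟩ := Y
    have := h.choose_spec
    simp only [Option.some.injEq, Prod.mk.injEq]
    constructor
    · rintro ⟨h1, h2⟩; exact ⟨h1, by rw [← h2]; exact this.symm⟩
    · rintro ⟨h1, h2⟩; exact ⟨h1, hι (by rw [← h2]; exact this)⟩
  · simp only [false_iff]
    rintro rfl
    exact h ⟨_, rfl⟩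

theorem back_fwd (hι : Function.Injective ι) (Y : Letter α') : back ι (fwd ι Y) = some Y :=
  (back_eq_some hι).2 rfl

theorem fwd_injective (hι : Function.Injective ι) : Function.Injective (fwd ι) := by
  rintro ⟨a, b⟩ ⟨c, d⟩ h
  simpa [fwd, hι.eq_iff] using h

open Classical in
theorem count_filterMap_back (hι : Function.Injective ι) (w : List (Letter α)) (Y : Letter α') :
    (w.filterMap (back ι)).count Y = w.count (fwd ι Y) := by
  induction w with
  | nil => simp
  | cons X w ih =>
    rw [List.filterMap_cons]
    cases h : back ι X with
    | none =>
      have : X ≠ fwd ι Y := by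
        rintro rfl
        simp [back_fwd hι] at h
      simp [ih, this]
    | some Z =>
      rw [back_eq_some hι] at h
      subst h
      simp [ih, List.count_cons, (fwd_injective hι).eq_iff]

theorem flatten_map_filterMap {β γ : Type*} (g : β → Option γ) (l : List (List β)) :
    (l.map (List.filterMap g)).flatten = l.flatten.filterMap g := by
  rw [List.filterMap_flatten]

theorem lead_map_filterMap {β γ : Type*} (g : β → Option γ) (k : ℕ) (l : List (List β)) :
    lead (l.map (List.filterMap g)) = process (fun _ => [none]) g k (lead l) := by
  induction l generalizing k with
  | nil => simp [lead, process]
  | cons w l ih =>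
    simp only [List.map_cons, lead, process, process_append, process_map_some, bars_map_some,
      Nat.add_zero, ← ih (k + 1), List.cons_append, List.nil_append]

theorem Gauss.proj (hι : Function.Injective ι) {l : Phrase α} (h : Gauss l) :
    Gauss (proj ι l) := by
  classical
  intro Y hY
  rw [Phrase.proj, flatten_map_filterMap] at hY ⊢
  rw [count_filterMap_back hι]
  simp only [List.mem_filterMap, back_eq_some hι] at hY
  obtain ⟨X, hX, rfl⟩ := hY
  exact h _ hX

theorem eraseAt_eq (i : ℕ) (l : Phrase α) :
    eraseAt i l = l.map (List.filterMap (open Classical in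
      Option.guard fun X => decide (X ∉ l.getD i []))) := by
  classical
  simp [eraseAt, List.filterMap_eq_filter]

theorem flatten_eraseAt (i : ℕ) (l : Phrase α) :
    (eraseAt i l).flatten = l.flatten.filter (open Classical in fun X => X ∉ l.getD i []) := by
  classical
  rw [eraseAt_eq, flatten_map_filterMap, List.filterMap_eq_filter]

theorem Gauss.eraseAt {l : Phrase α} (i : ℕ) (h : Gauss l) : Gauss (eraseAt i l) := by
  classical
  intro X hX
  rw [flatten_eraseAt] at hX ⊢
  rw [List.mem_filter] at hX
  exact (List.count_filter (by simpa using hX.2)).trans (h X hX.1)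

theorem Gauss.mergeAt {l : Phrase α} (i : ℕ) (h : Gauss l) : Gauss (mergeAt i l) :=
  (Gauss.of_perm (by rw [flatten_mergeAt])).1 h

theorem Gauss.removeBars {l : Phrase α} {s : ℕ → Bool} {k : ℕ} (hs : s k = false)
    (h : Gauss l) : Gauss (removeBars s k l).2 :=
  (Gauss.of_perm (by rw [flatten_removeBars_snd hs])).1 h

end

/-- The positions of the letters: each letter with the number of bars, plus `k`, before it. -/
def positions {β : Type*} : ℕ → List (Option β) → List (ℕ × β)
  | _, [] => []
  | k, none :: T => positions (k + 1) T
  | k, some X :: T => (k, X) :: positions k T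

section

variable {β : Type*}

@[simp] theorem positions_append (k : ℕ) (x y : List (Option β)) :
    positions k (x ++ y) = positions k x ++ positions (k + bars x) y := by
  induction x generalizing k with
  | nil => simp [positions, bars]
  | cons a x ih =>
    cases a with
    | none => simp [positions, bars, ih, Nat.add_assoc, Nat.add_comm 1]
    | some X => simp [positions, bars, ih]

theorem mem_letters_of_mem_positions {j k : ℕ} {X : β} {T : List (Option β)}
    (h : (j, X) ∈ positions k T) : X ∈ letters T := by
  induction T generalizing k with
  | nil => simp [positions] at h
  | cons a T ih =>
    cases a with
    | none => exact ih h
    | some Y =>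
      simp only [positions, List.mem_cons, Prod.mk.injEq] at h
      rcases h with ⟨_, rfl⟩ | h
      · simp [letters]
      · simp [letters, ih h]

theorem le_of_mem_positions {j k : ℕ} {X : β} {T : List (Option β)}
    (h : (j, X) ∈ positions k T) : k ≤ j := by
  induction T generalizing k with
  | nil => simp [positions] at h
  | cons a T ih =>
    cases a with
    | none => exact (Nat.le_succ k).trans (ih h)
    | some Y =>
      simp only [positions, List.mem_cons, Prod.mk.injEq] at h
      rcases h with ⟨rfl, _⟩ | h
      · exact le_rfl
      · exact ih h

theorem positions_map_some (k : ℕ) (w : List β) :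
    positions k (w.map some) = w.map (Prod.mk k) := by
  induction w with
  | nil => simp [positions]
  | cons a w ih => simp [positions, ih]

/-- The extra `1` counts the bar with which `lead` introduces the component itself. -/
theorem mem_getD_iff_mem_positions (i k : ℕ) (X : β) (l : List (List β)) :
    X ∈ l.getD i [] ↔ (k + i + 1, X) ∈ positions k (lead l) := by
  induction l generalizing i k with
  | nil => simp [lead, positions]
  | cons w l ih =>
    cases i with
    | zero =>
      have : (k + 1, X) ∉ positions (k + 1) (lead l) := by
        rw [show k + 1 = k + 0 + 1 from rfl]
        cases l with
        | nil => simp [lead, positions]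
        | cons v l =>
          intro h
          have := le_of_mem_positions (k := k + 1 + 1) (T := v.map some ++ lead l)
            (by simpa [lead, positions] using h)
          omega
      simp [lead, positions, positions_map_some, this]
    | succ i =>
      have := ih i (k + 1)
      rw [show k + 1 + i + 1 = k + (i + 1) + 1 by omega] at this
      simp only [List.getD_cons_succ, this, lead, positions, positions_append, positions_map_some,
        bars_map_some, List.mem_append, List.mem_map, Prod.mk.injEq]
      constructor
      · exact .inr
      · rintro (⟨_, _, h, _⟩ | h)
        · omega
        · exact h

end

end Phrase

/-! ### Joining and erasing respect homotopy -/

namespace HomotopyDataTriple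

open Phrase

variable {α α' : Type*} {H : HomotopyDataTriple α} {H' : HomotopyDataTriple α'}

theorem PhraseHomotopic.removeBars {s : ℕ → Bool} {k : ℕ} (hs : s k = false) {l l' : Phrase α}
    (h : H.PhraseHomotopic l l') :
    H.PhraseHomotopic (removeBars s k l).2 (removeBars s k l').2 := by
  refine PhraseHomotopic.map (op := fun l => (Phrase.removeBars s k l).2)
    (fun l hl => hl.removeBars hs) (fun f l hl hl' hf => ?_) (fun l l' hl hl' h => ?_) h
  · simp only [removeBars_map]
    refine .of_renaming (hl.removeBars hs) ?_ ⟨?_, ?_⟩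
    · rw [Gauss.of_perm (l' := l.map (List.map f))]
      · exact hl'
      · rw [← List.map_flatten, ← List.map_flatten, flatten_removeBars_snd hs]
    · rw [flatten_removeBars_snd hs]; exact hf.inj
    · rw [flatten_removeBars_snd hs]; exact hf.proj
  · refine .of_eq_or_move (hl.removeBars hs) (hl'.removeBars hs) ?_
    rw [lead_removeBars_snd hs, lead_removeBars_snd hs]
    exact h.process k (fun A B _ _ _ _ h => .inr ⟨A, B, rfl, rfl, h⟩)
      (fun A B C _ _ _ _ _ h => .inr (.inr (.inr ⟨A, B, C, rfl, rfl, rfl, h⟩)))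

theorem PhraseHomotopic.mergeAt {l l' : Phrase α} (i : ℕ) (h : H.PhraseHomotopic l l') :
    H.PhraseHomotopic (mergeAt i l) (mergeAt i l') := by
  have e := fun l : Phrase α => congrArg Prod.snd (mergeAt_eq_removeBars i 0 l)
  simp only at e
  rw [e, e]
  exact h.removeBars (by simp)

theorem eraseAt_map {f : Letter α → Letter α} {l : Phrase α}
    (hf : Set.InjOn f {X | X ∈ l.flatten}) (i : ℕ) :
    eraseAt i (l.map (List.map f)) = (eraseAt i l).map (List.map f) := by
  classical
  simp only [eraseAt, List.map_map, List.map_inj_left, Function.comp, List.filter_map]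
  intro w hw
  congr 1
  apply List.filter_congr
  intro X hX
  have hg : (l.map (List.map f)).getD i [] = (l.getD i []).map f := by
    simp [List.getD_eq_getElem?_getD, List.getElem?_map]
    cases l[i]? <;> simp
  simp only [hg, decide_eq_decide, List.mem_map, Function.comp]
  refine not_congr ⟨?_, fun h => ⟨X, h, rfl⟩⟩
  rintro ⟨Y, hY, hYX⟩
  have : Y ∈ l.flatten := by
    rw [List.getD_eq_getElem?_getD] at hY
    cases h : l[i]? with
    | none => simp [h] at hY
    | some v =>
      simp only [h, Option.getD_some] at hY
      exact List.mem_flatten.2 ⟨v, List.mem_of_getElem? h, hY⟩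
  rwa [← hf this (List.mem_flatten.2 ⟨w, hw, hX⟩) hYX]

theorem IsRenaming.mono {f : Letter α → Letter α} {l l' : Phrase α} (h : IsRenaming f l)
    (hl : ∀ X ∈ l'.flatten, X ∈ l.flatten) : IsRenaming f l' :=
  ⟨h.inj.mono hl, fun X hX => h.proj X (hl X hX)⟩

-- A move never carries a letter across a bar. The Gauss conditions exclude that a letter removed by
-- H1 or H2 still occurs in the result.
open Classical in
theorem TokenMove.mem_positions_iff {T T' : List (Option (Letter α))} (h : H.TokenMove T T')
    (hT : ∀ X ∈ letters T, (letters T).count X = 2)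
    (hT' : ∀ X ∈ letters T', (letters T').count X = 2) (m : ℕ) {X : Letter α}
    (hX : X ∈ letters T') : (m, X) ∈ positions 0 T ↔ (m, X) ∈ positions 0 T' := by
  have hX2 := hT X
  have hX2' := hT' X hX
  cases h with
  | h1 A x y =>
    by_cases hne : X = A
    · subst hne
      simp [letters] at hX2 hX2'; omega
    · simp [positions, hne]
  | h2 A B x y z h =>
    by_cases hne : X = A
    · subst hne
      simp [letters, List.count_cons] at hX2 hX2'; omega
    · by_cases hne' : X = B
      · subst hne'
        simp [letters, List.count_cons] at hX2 hX2'; omega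
      · simp [positions, hne, hne']
  | h3 A B C x y z t h =>
    simp only [positions_append, positions, bars_append, bars, List.mem_append, List.mem_cons,
      List.not_mem_nil, or_false]
    simp only [or_comm]

-- Each pair of letters in a move lies inside one component. In H2 both pairs consist of `A` and
-- `B`, so a component meets both or neither. In H3 the pairs are `AB`, `AC`, `BC`, so a component
-- that contains one of the three letters contains at least two of them.
open Classical in
theorem TokenMove.process_erase {T T' : List (Option (Letter α))} (h : H.TokenMove T T')
    (hT : ∀ X ∈ letters T, (letters T).count X = 2)
    (hT' : ∀ X ∈ letters T', (letters T').count X = 2) (m : ℕ) :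
    Phrase.process (fun _ => [none]) (Option.guard fun X => decide ((m, X) ∉ positions 0 T)) 0 T =
      Phrase.process (fun _ => [none]) (Option.guard fun X => decide ((m, X) ∉ positions 0 T')) 0 T' ∨
    H.TokenMove
      (Phrase.process (fun _ => [none]) (Option.guard fun X => decide ((m, X) ∉ positions 0 T)) 0 T)
      (Phrase.process (fun _ => [none]) (Option.guard fun X => decide ((m, X) ∉ positions 0 T')) 0 T') := by
  have key : ∀ {x : List (Option (Letter α))} {C : Letter α}, (letters x).count C = 0 →
      ∀ k j, (j, C) ∉ positions k x :=
    fun hC k j h => List.count_eq_zero.1 hC (mem_letters_of_mem_positions h)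
  -- On the letters of `T'` the two deletion rules agree, so a single rule can be used on both sides
  -- of the move.
  rw [process_congr (T := T')
    (g' := Option.guard fun X => decide ((m, X) ∉ positions 0 T)) 0]
  · refine h.process 0 (fun A B x y z e hAB => ?_) (fun A B C x y z t e hABC => ?_)
    · have hA := hT A (by simp [e, letters])
      have hB := hT B (by simp [e, letters])
      have hne : A ≠ B := by
        rintro rfl
        simp [e, letters] at hA; omega
      simp [e, letters, hne, hne.symm] at hA hB
      have hA1 := key (show (letters x).count A = 0 by omega)
      have hA2 := key (show (letters y).count A = 0 by omega)
      have hA3 := key (show (letters z).count A = 0 by omega)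
      have hB1 := key (show (letters x).count B = 0 by omega)
      have hB2 := key (show (letters y).count B = 0 by omega)
      have hB3 := key (show (letters z).count B = 0 by omega)
      simp [e, positions, Option.guard, hA1, hA2, hA3, hB1, hB2, hB3, hne, hne.symm]
      grind
    · have hA := hT A (by simp [e, letters])
      have hB := hT B (by simp [e, letters])
      have hC := hT C (by simp [e, letters])
      have hne : A ≠ B := by
        rintro rfl
        simp [e, letters, List.count_cons] at hA; omega
      have hne' : A ≠ C := by
        rintro rfl
        simp [e, letters, List.count_cons] at hA; omega
      have hne'' : B ≠ C := by
        rintro rfl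
        simp [e, letters, List.count_cons] at hB; omega
      simp [e, letters, hne, hne.symm, hne', hne'.symm, hne'', hne''.symm]
        at hA hB hC
      have hA1 := key (show (letters x).count A = 0 by omega)
      have hA2 := key (show (letters y).count A = 0 by omega)
      have hA3 := key (show (letters z).count A = 0 by omega)
      have hA4 := key (show (letters t).count A = 0 by omega)
      have hB1 := key (show (letters x).count B = 0 by omega)
      have hB2 := key (show (letters y).count B = 0 by omega)
      have hB3 := key (show (letters z).count B = 0 by omega)
      have hB4 := key (show (letters t).count B = 0 by omega)
      have hC1 := key (show (letters x).count C = 0 by omega)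
      have hC2 := key (show (letters y).count C = 0 by omega)
      have hC3 := key (show (letters z).count C = 0 by omega)
      have hC4 := key (show (letters t).count C = 0 by omega)
      simp [e, positions, Option.guard, hA1, hA2, hA3, hA4, hB1, hB2, hB3, hB4, hC1, hC2, hC3,
        hC4, hne, hne.symm, hne', hne'.symm, hne'', hne''.symm]
      grind
  · intro X hX
    simp only [Option.guard, h.mem_positions_iff hT hT' m hX]

theorem PhraseHomotopic.eraseAt {l l' : Phrase α} (i : ℕ) (h : H.PhraseHomotopic l l') :
    H.PhraseHomotopic (eraseAt i l) (eraseAt i l') := by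
  classical
  refine PhraseHomotopic.map (op := fun l => Phrase.eraseAt i l)
    (fun l hl => hl.eraseAt i) (fun f l hl hl' hf => ?_) (fun l l' hl hl' h => ?_) h
  · have hg := hl'.eraseAt i
    rw [eraseAt_map hf.inj] at hg ⊢
    refine .of_renaming (hl.eraseAt i) hg (hf.mono fun X hX => ?_)
    rw [flatten_eraseAt] at hX
    exact (List.mem_filter.1 hX).1
  · refine .of_eq_or_move (hl.eraseAt i) (hl'.eraseAt i) ?_
    rw [eraseAt_eq, eraseAt_eq, lead_map_filterMap _ 0, lead_map_filterMap _ 0]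
    simp only [mem_getD_iff_mem_positions i 0]
    exact h.process_erase (by rw [letters_lead]; exact hl) (by rw [letters_lead]; exact hl') _

end HomotopyDataTriple

/-! ### Factors: projection, recombination and pure phrases -/

namespace HomotopyDataTriple

open Phrase

variable {α α' : Type*} {H : HomotopyDataTriple α} {H' : HomotopyDataTriple α'} {ι : α' → α}

/-- `ι` identifies `H'` with a factor of `H`. -/
structure IsFactorMap (H' : HomotopyDataTriple α') (H : HomotopyDataTriple α) (ι : α' → α) :
    Prop where
  inj : Function.Injective ι
  map_τ : ∀ a, ι (H'.τ a) = H.τ (ι a)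
  mem_S : ∀ a b c, (a, b, c) ∈ H'.S ↔ (ι a, ι b, ι c) ∈ H.S
  dichotomy : ∀ a b c, (a, b, c) ∈ H.S →
    (a ∈ Set.range ι ∧ b ∈ Set.range ι ∧ c ∈ Set.range ι) ∨
      (a ∉ Set.range ι ∧ b ∉ Set.range ι ∧ c ∉ Set.range ι)

theorem PhraseHomotopic.proj (hι : IsFactorMap H' H ι) {l l' : Phrase α}
    (h : H.PhraseHomotopic l l') : H'.PhraseHomotopic (proj ι l) (proj ι l') := by
  refine PhraseHomotopic.map (op := Phrase.proj ι)
    (fun l hl => hl.proj hι.inj) (fun f l hl hl' hf => ?_) (fun l l' hl hl' h => ?_) h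
  · have hmem : ∀ Y ∈ (Phrase.proj ι l).flatten, fwd ι Y ∈ l.flatten := by
      intro Y hY
      rw [Phrase.proj, flatten_map_filterMap] at hY
      simp only [List.mem_filterMap, back_eq_some hι.inj] at hY
      obtain ⟨X, hX, rfl⟩ := hY
      exact hX
    -- A renaming preserves projections, so it induces a renaming over `α'` that changes only the
    -- names.
    have e : Phrase.proj ι (l.map (List.map f)) =
        (Phrase.proj ι l).map (List.map fun Y => ((f (fwd ι Y)).1, Y.2)) := by
      simp only [Phrase.proj, List.map_map, List.map_inj_left, Function.comp, List.filterMap_map,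
        List.map_filterMap]
      intro w hw
      apply List.filterMap_congr
      intro X hX
      have hp : (f X).2 = X.2 := hf.proj X (List.mem_flatten.2 ⟨w, hw, hX⟩)
      cases h : back ι X with
      | none =>
        rw [back_eq_none] at h
        simp only [Option.map_none, back_eq_none, hp, h, not_false_eq_true]
      | some Y =>
        rw [back_eq_some hι.inj] at h
        subst h
        simp only [Option.map_some, back_eq_some hι.inj]
        exact Prod.ext rfl hp
    have hg := hl'.proj hι.inj
    rw [e] at hg ⊢
    refine .of_renaming (hl.proj hι.inj) hg ⟨?_, fun Y _ => rfl⟩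
    intro Y hY Z hZ hYZ
    apply fwd_injective hι.inj
    apply hf.inj (hmem Y hY) (hmem Z hZ)
    simp only [Prod.mk.injEq] at hYZ
    refine Prod.ext hYZ.1 ?_
    rw [hf.proj _ (hmem Y hY), hf.proj _ (hmem Z hZ)]
    exact congrArg ι hYZ.2
  · refine .of_eq_or_move (hl.proj hι.inj) (hl'.proj hι.inj) ?_
    rw [Phrase.proj, Phrase.proj, lead_map_filterMap _ 0, lead_map_filterMap _ 0]
    have hsome : ∀ X : Letter α, X.2 ∈ Set.range ι → ∃ Y, back ι X = some Y := by
      rintro ⟨n, _⟩ ⟨a, rfl⟩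
      exact ⟨(n, a), back_fwd hι.inj (n, a)⟩
    refine h.process 0 (fun A B _ _ _ _ h => ?_) (fun A B C _ _ _ _ _ h => ?_)
    · by_cases hA : A.2 ∈ Set.range ι
      · right
        obtain ⟨A', hA'⟩ := hsome A hA
        have hA2 := (back_eq_some hι.inj).1 hA'
        subst hA2
        refine ⟨A', (B.1, H'.τ A'.2), hA', ?_, rfl⟩
        rw [back_eq_some hι.inj]
        refine Prod.ext rfl ?_
        rw [← h]
        exact (hι.map_τ A'.2).symm
      · left
        -- Since `τ` is an involution, the complement of the range is invariant as well, so both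
        -- letters of H2 are deleted together.
        refine ⟨back_eq_none.2 hA, back_eq_none.2 fun ⟨b, hb⟩ => hA ⟨H'.τ b, ?_⟩⟩
        rw [hι.map_τ, hb, ← h, H.involutive]
    · rcases hι.dichotomy _ _ _ h with ⟨hA, hB, hC⟩ | ⟨hA, hB, _⟩
      · obtain ⟨A', hA'⟩ := hsome A hA
        obtain ⟨B', hB'⟩ := hsome B hB
        obtain ⟨C', hC'⟩ := hsome C hC
        refine .inr (.inr (.inr ⟨A', B', C', hA', hB', hC', ?_⟩))
        rw [back_eq_some hι.inj] at hA' hB' hC'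
        subst hA' hB' hC'
        exact (hι.mem_S _ _ _).2 h
      · exact .inl ⟨back_eq_none.2 hA, back_eq_none.2 hB⟩

section Zip

/-- Put the components of `q` in front of the components of the image of `l` under `ι`. -/
def zipBefore (ι : α' → α) (q : Phrase α) (l : Phrase α') : Phrase α :=
  List.zipWith (· ++ ·) q (l.map (List.map (fwd ι)))

theorem perm_flatten_zipWith_append {β : Type*} {l l' : List (List β)} (h : l.length = l'.length) :
    (List.zipWith (· ++ ·) l l').flatten.Perm (l.flatten ++ l'.flatten) := by
  induction l generalizing l' with
  | nil =>
    rw [List.length_eq_zero_iff.1 h.symm]; simp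
  | cons w l ih =>
    cases l' with
    | nil => simp at h
    | cons w' l' =>
      simp only [List.zipWith_cons_cons, List.flatten_cons, List.append_assoc]
      refine List.Perm.append_left w (((ih (by simpa using h)).append_left w').trans ?_)
      rw [← List.append_assoc, ← List.append_assoc]
      exact List.Perm.append_right _ List.perm_append_comm

/-- Prepending the words of `q` amounts to replacing each bar by that bar followed by a word of `q`,
which brings zipping within the scope of `TokenMove.process`. -/
theorem lead_zipBefore (b : ℕ → List (Option (Letter α))) (k : ℕ) (q : Phrase α) (l : Phrase α')
    (h : q.length = l.length) (hb : ∀ j, b (k + j) = none :: (q.getD j []).map some) :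
    lead (zipBefore ι q l) = process b (some ∘ fwd ι) k (lead l) := by
  induction l generalizing k q with
  | nil => simp_all [zipBefore, lead, process]
  | cons w l ih =>
    cases q with
    | nil => simp at h
    | cons v q =>
      have := ih (k + 1) q (by simpa using h) fun j => by
        rw [Nat.add_assoc, Nat.add_comm 1, hb]; simp
      simp only [zipBefore] at this
      have h0 := hb 0
      simp only [Nat.add_zero, List.getD_cons_zero] at h0
      simp [zipBefore, lead, process, process_map_some, this, h0]

theorem gauss_zipBefore (hι : Function.Injective ι) {q : Phrase α} {l : Phrase α'}
    (h : q.length = l.length) (hq : Gauss q) (hdisj : ∀ X ∈ q.flatten, X.2 ∉ Set.range ι)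
    (hl : Gauss l) : Gauss (zipBefore ι q l) := by
  classical
  have hp := perm_flatten_zipWith_append (l := q) (l' := l.map (List.map (fwd ι))) (by simpa using h)
  intro X hX
  unfold zipBefore at hX ⊢
  rw [hp.mem_iff, List.mem_append] at hX
  refine (hp.count_eq X).trans ?_
  rw [List.count_append]
  rw [← List.map_flatten] at hX ⊢
  by_cases hr : X.2 ∈ Set.range ι
  · obtain ⟨a, ha⟩ := hr
    obtain ⟨Y, rfl⟩ : ∃ Y, X = fwd ι Y := ⟨(X.1, a), Prod.ext rfl ha.symm⟩
    have hnq : fwd ι Y ∉ q.flatten := fun hc => hdisj _ hc ⟨_, ha⟩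
    rw [List.count_eq_zero_of_not_mem hnq, List.count_map_of_injective _ _ (fwd_injective hι),
      zero_add]
    refine hl Y ?_
    rcases hX with hX | hX
    · exact absurd hX hnq
    · obtain ⟨Z, hZ, e⟩ := List.mem_map.1 hX
      rwa [← fwd_injective hι e]
  · have hnl : X ∉ l.flatten.map (fwd ι) := fun hc => by
      obtain ⟨Z, hZ, rfl⟩ := List.mem_map.1 hc
      exact hr ⟨_, rfl⟩
    rw [List.count_eq_zero_of_not_mem hnl, add_zero]
    exact hq X (hX.resolve_right hnl)

theorem PhraseHomotopic.zipBefore (hι : IsFactorMap H' H ι) {q : Phrase α} (hq : Gauss q)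
    (hdisj : ∀ X ∈ q.flatten, X.2 ∉ Set.range ι) {l l' : Phrase α'}
    (hlen : q.length = l.length) (h : H'.PhraseHomotopic l l') :
    H.PhraseHomotopic (zipBefore ι q l) (zipBefore ι q l') := by
  classical
  -- `List.zipWith` truncates, which could cut off one of the two occurrences of a letter. The value
  -- `[]` for unequal lengths makes the operation preserve Gauss phrases everywhere.
  have := PhraseHomotopic.map (H := H') (H' := H) (op := fun l : Phrase α' =>
    if q.length = l.length then HomotopyDataTriple.zipBefore ι q l else []) ?_ ?_ ?_ h
  · simpa only [← h.length_eq, hlen, if_true] using this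
  · intro l hl
    split_ifs with h
    · exact gauss_zipBefore hι.inj h hq hdisj hl
    · intro X hX; simp at hX
  · intro f l hl hl' hf
    simp only [List.length_map]
    split_ifs with h
    · have hg := gauss_zipBefore hι.inj (by simpa using h) hq hdisj hl'
      -- The extended renaming fixes the letters of `q`, which have no preimage under `fwd ι`, and
      -- acts by `f` on the others.
      have e : HomotopyDataTriple.zipBefore ι q (l.map (List.map f)) =
          (HomotopyDataTriple.zipBefore ι q l).map (List.map fun X =>
            ((back ι X).elim X fun Y => fwd ι (f Y))) := by
        simp only [HomotopyDataTriple.zipBefore, List.map_zipWith, List.map_append, List.map_map]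
        rw [List.zipWith_map_right, List.zipWith_map_right]
        clear hg hlen h hl hl' hf hq
        induction q generalizing l with
        | nil => simp
        | cons v q ih =>
          cases l with
          | nil => simp
          | cons w l =>
            simp only [List.zipWith_cons_cons]
            congr 1
            · congr 1
              · conv_lhs => rw [← List.map_id v]
                apply List.map_congr_left
                intro X hX
                rw [back_eq_none.2 (hdisj X (by simp [hX]))]
                rfl
              · simp only [Function.comp, List.map_map]
                apply List.map_congr_left
                intro Y hY
                simp [back_fwd hι.inj]
            · exact ih (fun X hX => hdisj X (by
                rw [List.flatten_cons]; exact List.mem_append_right _ hX)) l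
      have hmem : ∀ X ∈ (HomotopyDataTriple.zipBefore ι q l).flatten,
          X ∈ q.flatten ∨ ∃ Y ∈ l.flatten, fwd ι Y = X := by
        intro X hX
        rw [HomotopyDataTriple.zipBefore,
          (perm_flatten_zipWith_append (by simpa using h)).mem_iff, ← List.map_flatten,
          List.mem_append, List.mem_map] at hX
        exact hX
      rw [e] at hg ⊢
      refine .of_renaming (gauss_zipBefore hι.inj h hq hdisj hl) hg ⟨?_, ?_⟩
      · intro X hX Z hZ hXZ
        replace hX := hmem X hX
        replace hZ := hmem Z hZ
        rcases hX with hX | ⟨X, hX, rfl⟩ <;> rcases hZ with hZ | ⟨Z, hZ, rfl⟩ <;>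
          simp only [back_fwd hι.inj, Option.elim] at hXZ
        · rwa [back_eq_none.2 (hdisj X hX), back_eq_none.2 (hdisj Z hZ)] at hXZ
        · rw [back_eq_none.2 (hdisj X hX)] at hXZ
          exact absurd ⟨_, (congrArg Prod.snd hXZ).symm⟩ (hdisj X hX)
        · rw [back_eq_none.2 (hdisj Z hZ)] at hXZ
          exact absurd ⟨_, congrArg Prod.snd hXZ⟩ (hdisj Z hZ)
        · rw [hf.inj hX hZ (fwd_injective hι.inj hXZ)]
      · intro X hX
        replace hX := hmem X hX
        rcases hX with hX | ⟨X, hX, rfl⟩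
        · rw [back_eq_none.2 (hdisj X hX)]; rfl
        · simp only [back_fwd hι.inj, Option.elim]
          exact congrArg ι (hf.proj X hX)
    · exact .refl fun X hX => by simp at hX
  · intro l l' hl hl' h
    have hlen' : l.length = l'.length := by simpa using h.bars_eq
    simp only [← hlen']
    split_ifs with hq'
    · have hq'' := hq'.trans hlen'
      refine .of_eq_or_move (gauss_zipBefore hι.inj hq' hq hdisj hl)
        (gauss_zipBefore hι.inj hq'' hq hdisj hl') ?_
      rw [lead_zipBefore (fun k => none :: (q.getD k []).map some) 0 q l hq' (by simp),
        lead_zipBefore (fun k => none :: (q.getD k []).map some) 0 q l' hq'' (by simp)]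
      refine h.process 0 (fun A B _ _ _ _ h => .inr ⟨_, _, rfl, rfl, ?_⟩)
        (fun A B C _ _ _ _ _ h => .inr (.inr (.inr ⟨_, _, _, rfl, rfl, rfl, ?_⟩)))
      · simp only [fwd]; rw [← hι.map_τ, h]
      · exact (hι.mem_S _ _ _).1 h
    · exact .refl fun X hX => by simp at hX

end Zip

/-- All letters of the `i`th component have projections to which `c` gives the value `t i`. -/
def Pure (c : α → ℕ) (t : List ℕ) (l : Phrase α) : Prop :=
  List.Forall₂ (fun n w => ∀ X ∈ w, c X.2 = n) t l

section Split

variable {α₁ α₂ : Type*} {H₁ : HomotopyDataTriple α₁} {H₂ : HomotopyDataTriple α₂}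
  {ι₁ : α₁ → α} {ι₂ : α₂ → α}

theorem map_fwd_filterMap_back (hι : Function.Injective ι) {w : List (Letter α)}
    (h : ∀ X ∈ w, X.2 ∈ Set.range ι) : (w.filterMap (back ι)).map (fwd ι) = w := by
  induction w with
  | nil => rfl
  | cons X w ih =>
    simp only [List.mem_cons, forall_eq_or_imp] at h
    obtain ⟨⟨a, ha⟩, h⟩ := h
    have : back ι X = some (X.1, a) := (back_eq_some hι).2 (Prod.ext rfl ha.symm)
    simp [this, ih h, fwd, ha]

theorem filterMap_back_eq_nil {w : List (Letter α)}
    (h : ∀ X ∈ w, X.2 ∉ Set.range ι) : w.filterMap (back ι) = [] := by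
  rw [List.filterMap_eq_nil_iff]
  exact fun X hX => back_eq_none.2 (h X hX)

theorem gauss_map_fwd (hι : Function.Injective ι) {l : Phrase α'} (h : Gauss l) :
    Gauss (l.map (List.map (fwd ι))) := by
  classical
  intro X hX
  rw [← List.map_flatten] at hX ⊢
  obtain ⟨Y, hY, rfl⟩ := List.mem_map.1 hX
  exact (List.count_map_of_injective _ _ (fwd_injective hι) _).trans (h Y hY)

theorem mem_range_of_mem_map_fwd {l : Phrase α'} {X : Letter α}
    (h : X ∈ (l.map (List.map (fwd ι))).flatten) : X.2 ∈ Set.range ι := by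
  rw [← List.map_flatten] at h
  obtain ⟨Y, hY, rfl⟩ := List.mem_map.1 h
  exact ⟨_, rfl⟩

/-- For pure phrases with the same tags, homotopy can be tested on the two projections. -/
theorem phraseHomotopic_iff_of_pure (h₁ : IsFactorMap H₁ H ι₁) (h₂ : IsFactorMap H₂ H ι₂)
    (hc : ∀ a, a ∈ Set.range ι₁ ↔ a ∉ Set.range ι₂) {c : α → ℕ}
    (hcc : ∀ a b, c a = c b → (a ∈ Set.range ι₁ ↔ b ∈ Set.range ι₁)) {t : List ℕ} {l l' : Phrase α}
    (hl : Gauss l) (hl' : Gauss l') (hp : Pure c t l) (hp' : Pure c t l') :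
    H.PhraseHomotopic l l' ↔
      H₁.PhraseHomotopic (proj ι₁ l) (proj ι₁ l') ∧ H₂.PhraseHomotopic (proj ι₂ l) (proj ι₂ l') := by
  refine ⟨fun h => ⟨h.proj h₁, h.proj h₂⟩, fun ⟨e₁, e₂⟩ => ?_⟩
  -- In each component, one of the two words that are put together is empty, so their order does not
  -- matter; for `l = l'` the two projections reassemble `l`.
  have key : ∀ {t : List ℕ} {l l' : Phrase α}, Pure c t l → Pure c t l' →
      zipBefore ι₁ ((proj ι₂ l).map (List.map (fwd ι₂))) (proj ι₁ l') =
      zipBefore ι₂ ((proj ι₁ l').map (List.map (fwd ι₁))) (proj ι₂ l) ∧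
      (l = l' → zipBefore ι₁ ((proj ι₂ l).map (List.map (fwd ι₂))) (proj ι₁ l') = l) := by
    clear hl hl' hp hp' e₁ e₂
    intro t l l' hp
    induction hp generalizing l' with
    | nil =>
      intro hp'
      cases hp'
      simp [zipBefore, proj]
    | @cons n w t l hw hp ih =>
      intro hp'
      cases hp' with
      | @cons _ w' _ l' hw' hp' =>
        obtain ⟨ih, ih'⟩ := ih hp'
        simp only [zipBefore, proj, List.map_cons, List.zipWith_cons_cons] at ih ih' ⊢
        rw [ih]
        -- Both words belong to the same tag, so they cannot have letters in different factors.
        have hor : (∀ X ∈ w, X.2 ∉ Set.range ι₂) ∨ (∀ X ∈ w', X.2 ∉ Set.range ι₁) := by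
          by_contra! hcon
          obtain ⟨⟨X, hX, hX'⟩, ⟨Y, hY, hY'⟩⟩ := hcon
          exact (hc X.2).1 ((hcc _ _ ((hw X hX).trans (hw' Y hY).symm)).2 hY') hX'
        constructor
        · congr 1
          rcases hor with hor | hor <;> simp [filterMap_back_eq_nil hor]
        · intro he
          simp only [List.cons.injEq] at he
          obtain ⟨rfl, rfl⟩ := he
          rw [← ih, ih' rfl]
          congr 1
          rcases hor with hor | hor
          · rw [filterMap_back_eq_nil hor, map_fwd_filterMap_back h₁.inj fun X hX =>
              (hc _).2 (hor X hX)]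
            rfl
          · rw [filterMap_back_eq_nil hor, map_fwd_filterMap_back h₂.inj fun X hX => by
              by_contra hn; exact hor X hX ((hc _).2 hn)]
            simp
  have hlen : l.length = l'.length := hp.length_eq.symm.trans hp'.length_eq
  -- The homotopy from `l` to `l'` runs in two stages: `s₁` changes the first projection while that
  -- of `l` to the second factor is fixed, and `s₂` changes the second projection while that of `l'`
  -- to the first factor is fixed.
  have s₁ := e₁.zipBefore h₁ (q := (proj ι₂ l).map (List.map (fwd ι₂)))
    (gauss_map_fwd h₂.inj (hl.proj h₂.inj)) (fun X hX hX' => (hc _).1 hX' (mem_range_of_mem_map_fwd hX))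
    (by simp [proj])
  have s₂ := e₂.zipBefore h₂ (q := (proj ι₁ l').map (List.map (fwd ι₁)))
    (gauss_map_fwd h₁.inj (hl'.proj h₁.inj)) (fun X hX hX' => (hc _).1 (mem_range_of_mem_map_fwd hX) hX')
    (by simp [proj, hlen])
  rw [(key hp hp).2 rfl, (key hp hp').1] at s₁
  rw [← (key hp' hp').1, (key hp' hp').2 rfl] at s₂
  exact s₁.trans s₂

end Split

end HomotopyDataTriple

/-! ### Commutation of joining, erasing and removing bars -/

namespace Phrase

section Lists

variable {β γ : Type*}

theorem mergeAt_map {F : List β → List γ} (hF : ∀ u v, F (u ++ v) = F u ++ F v) (i : ℕ)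
    (l : List (List β)) : mergeAt i (l.map F) = (mergeAt i l).map F := by
  induction l generalizing i with
  | nil => cases i <;> simp [mergeAt]
  | cons u l ih =>
    cases i with
    | zero => cases l <;> simp [mergeAt, hF]
    | succ i => simp [mergeAt, ih]

theorem mergeAt_mergeAt {i j : ℕ} (h : i ≤ j) (l : List (List β)) :
    mergeAt j (mergeAt i l) = mergeAt i (mergeAt (j + 1) l) := by
  induction l generalizing i j with
  | nil => cases i <;> cases j <;> simp [mergeAt]
  | cons u l ih =>
    cases i with
    | zero =>
      cases l with
      | nil => cases j <;> simp [mergeAt]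
      | cons v l =>
        cases j with
        | zero => cases l <;> simp [mergeAt]
        | succ j => simp [mergeAt]
    | succ i =>
      obtain ⟨j, rfl⟩ : ∃ j', j = j' + 1 := ⟨j - 1, by omega⟩
      simp [mergeAt, ih (show i ≤ j by omega)]

theorem length_mergeAt {i : ℕ} {l : List (List β)} (h : i + 1 < l.length) :
    (mergeAt i l).length + 1 = l.length := by
  induction l generalizing i with
  | nil => simp at h
  | cons u l ih =>
    cases i with
    | zero => cases l <;> simp_all [mergeAt]
    | succ i => simp [mergeAt, ih (i := i) (by simpa using h)]

theorem getD_mergeAt_of_lt {i j : ℕ} (h : j < i) (l : List (List β)) :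
    (mergeAt i l).getD j [] = l.getD j [] := by
  induction l generalizing i j with
  | nil => cases i <;> simp [mergeAt]
  | cons u l ih =>
    obtain ⟨i, rfl⟩ : ∃ i', i = i' + 1 := ⟨i - 1, by omega⟩
    cases j with
    | zero => simp [mergeAt]
    | succ j => simpa [mergeAt] using ih (show j < i by omega)

theorem getD_mergeAt_of_gt {i j : ℕ} (h : i < j) (l : List (List β)) :
    (mergeAt i l).getD j [] = l.getD (j + 1) [] := by
  induction l generalizing i j with
  | nil => cases i <;> simp [mergeAt]
  | cons u l ih =>
    obtain ⟨j, rfl⟩ : ∃ j', j = j' + 1 := ⟨j - 1, by omega⟩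
    cases i with
    | zero => cases l <;> simp [mergeAt]
    | succ i => simpa [mergeAt] using ih (show i < j by omega)

theorem getD_mergeAt_self (i : ℕ) (l : List (List β)) :
    (mergeAt i l).getD i [] = l.getD i [] ++ l.getD (i + 1) [] := by
  induction l generalizing i with
  | nil => cases i <;> simp [mergeAt]
  | cons u l ih =>
    cases i with
    | zero => cases l <;> simp [mergeAt]
    | succ i => simpa [mergeAt] using ih i

theorem mergeAt_eq_mergeAt_succ {i : ℕ} {l : List (List β)} (h : i + 2 < l.length)
    (h0 : l.getD (i + 1) [] = []) : mergeAt i l = mergeAt (i + 1) l := by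
  induction l generalizing i with
  | nil => simp at h
  | cons u l ih =>
    cases i with
    | zero =>
      match l with
      | [] => simp at h
      | [v] => simp at h
      | v :: w :: l => simp_all [mergeAt]
    | succ i =>
      simp only [mergeAt]
      rw [ih (by simp at h; omega) (by simpa using h0)]

theorem removeBars_shift {s s' : ℕ → Bool} {k k' : ℕ} (h : ∀ j, s' (k' + j) = s (k + j))
    (l : List (List β)) : removeBars s' k' l = removeBars s k l := by
  induction l generalizing k k' with
  | nil => rfl
  | cons u l ih =>
    have := ih (k := k + 1) (k' := k' + 1) fun j => by
      rw [Nat.add_assoc, Nat.add_assoc, h]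
    have h0 := h 0
    simp only [Nat.add_zero] at h0
    simp [removeBars, this, h0]

/-- If bar `k + i + 1` is to be removed anyway, joining at it beforehand changes only the numbering:
later bars move down by one. -/
theorem removeBars_mergeAt {s s' : ℕ → Bool} {i k : ℕ} {l : List (List β)}
    (hl : i + 1 < l.length) (hs : s (k + i + 1) = true) (hlt : ∀ j, j < k + i + 1 → s' j = s j)
    (hge : ∀ j, k + i + 1 ≤ j → s' j = s (j + 1)) :
    removeBars s' k (mergeAt i l) = removeBars s k l := by
  induction l generalizing i k with
  | nil => simp at hl
  | cons u l ih =>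
    cases i with
    | zero =>
      cases l with
      | nil => simp at hl
      | cons v l =>
        have := removeBars_shift (s := s) (s' := s') (k := k + 1 + 1) (k' := k + 1)
          (fun j => by rw [hge _ (by omega)]; congr 1; omega) l
        simp only [Nat.add_zero] at hs
        by_cases h : s k <;> simp [mergeAt, removeBars, this, hlt k (by omega), hs, h]
    | succ i =>
      have := ih (i := i) (k := k + 1) (by simpa using hl) (by rw [← hs]; congr 1; omega)
        (fun j hj => hlt j (by omega)) (fun j hj => hge j (by omega))
      simp [mergeAt, removeBars, this, hlt k (by omega)]

end Lists

section

variable {α : Type*}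

theorem eraseAt_mergeAt_of_lt {i j : ℕ} (h : i < j) (l : Phrase α) :
    eraseAt j (mergeAt i l) = mergeAt i (eraseAt (j + 1) l) := by
  classical
  simp only [eraseAt]
  rw [mergeAt_map (fun u v => List.filter_append ..), getD_mergeAt_of_gt h]

theorem eraseAt_mergeAt_of_gt {i j : ℕ} (h : j < i) (l : Phrase α) :
    eraseAt j (mergeAt i l) = mergeAt i (eraseAt j l) := by
  classical
  simp only [eraseAt]
  rw [mergeAt_map (fun u v => List.filter_append ..), getD_mergeAt_of_lt h]

open Classical in
theorem getD_eraseAt (i j : ℕ) (l : Phrase α) :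
    (eraseAt i l).getD j [] = (l.getD j []).filter fun X => X ∉ l.getD i [] := by
  simp only [eraseAt, List.getD_eq_getElem?_getD, List.getElem?_map]
  cases l[j]? <;> simp

/-- The joined component contains the letters of both parts. Hence a join of two reducible
components is reducible. -/
theorem eraseAt_mergeAt_self (i : ℕ) (l : Phrase α) :
    eraseAt i (mergeAt i l) = mergeAt i (eraseAt (i + 1) (eraseAt i l)) := by
  classical
  have e : eraseAt (i + 1) (eraseAt i l) =
      l.map (List.filter fun X => X ∉ l.getD i [] ++ l.getD (i + 1) []) := by
    rw [eraseAt, getD_eraseAt, eraseAt, List.map_map]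
    apply List.map_congr_left
    intro w _
    simp only [Function.comp, List.filter_filter]
    apply List.filter_congr
    intro X _
    simp only [List.mem_filter, List.mem_append, decide_eq_true_eq, ← Bool.decide_and,
      decide_eq_decide]
    tauto
  rw [e, mergeAt_map (fun u v => List.filter_append ..), eraseAt, getD_mergeAt_self]

theorem getD_eraseAt_self (i : ℕ) (l : Phrase α) : (eraseAt i l).getD i [] = [] := by
  classical
  rw [getD_eraseAt]
  simp

theorem eraseAt_eq_self {i : ℕ} {l : Phrase α} (h : l.getD i [] = []) : eraseAt i l = l := by
  classical
  simp only [eraseAt, h]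
  conv_rhs => rw [← List.map_id l]
  apply List.map_congr_left
  intro w _
  simp

theorem length_eraseAt (i : ℕ) (l : Phrase α) : (eraseAt i l).length = l.length := by
  simp [eraseAt]

end

end Phrase

/-! ### Rewriting of tagged phrases and its confluence -/

namespace HomotopyDataTriple

open Phrase Relation

variable {α : Type*} (H : HomotopyDataTriple α)

/-- In a tagged phrase, the component at position `i + 1` may be joined to the preceding one:
its tag is not `0`, and either both tags are the same or the component can be made empty. -/
def CanMerge (i : ℕ) (a : List ℕ × Phrase α) : Prop :=
  i + 1 < a.2.length ∧ ∃ d, d ≠ 0 ∧ a.1[i + 1]? = some d ∧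
    (a.1[i]? = some d ∨ H.PhraseHomotopic a.2 (eraseAt (i + 1) a.2))

/-- The rewriting relation on tagged phrases. -/
def Rewrites (a b : List ℕ × Phrase α) : Prop :=
  (a.1 = b.1 ∧ H.PhraseHomotopic a.2 b.2) ∨
    ∃ i, H.CanMerge i a ∧ b.1 = a.1.eraseIdx (i + 1) ∧ H.PhraseHomotopic (mergeAt i a.2) b.2

variable {H}

/-- Reducibility of a component is stated through `eraseAt`, which respects homotopy. -/
theorem CanMerge.congr {i : ℕ} {a b : List ℕ × Phrase α} (h : H.CanMerge i a)
    (hab : a.1 = b.1) (hab' : H.PhraseHomotopic a.2 b.2) : H.CanMerge i b := by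
  obtain ⟨hl, d, hd, h1, h2⟩ := h
  refine ⟨hab'.length_eq ▸ hl, d, hd, hab ▸ h1, ?_⟩
  rcases h2 with h2 | h2
  · exact .inl (hab ▸ h2)
  · exact .inr ((hab'.symm.trans h2).trans (hab'.eraseAt _))

theorem eraseIdx_eraseIdx_succ {β : Type*} {i j : ℕ} (h : i ≤ j) (t : List β) :
    (t.eraseIdx i).eraseIdx j = (t.eraseIdx (j + 1)).eraseIdx i := by
  apply List.ext_getElem?
  intro k
  simp only [List.getElem?_eraseIdx]
  split_ifs <;> first | rfl | omega

/-- Usually the two joins commute, and each remains permitted after the other. The exception is a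
reducible component `i + 1` followed by one with the same tag: joining at `i` discards the tag which
justified the join at `i + 1`. -/
theorem diamond_of_lt {a b c : List ℕ × Phrase α} {i j : ℕ} (hij : i < j) (hi : H.CanMerge i a)
    (hb : b.1 = a.1.eraseIdx (i + 1)) (hb' : H.PhraseHomotopic (mergeAt i a.2) b.2)
    (hj : H.CanMerge j a) (hc : c.1 = a.1.eraseIdx (j + 1))
    (hc' : H.PhraseHomotopic (mergeAt j a.2) c.2) :
    ∃ d, H.Rewrites b d ∧ H.Rewrites c d := by
  have hrefl : H.PhraseHomotopic c.2 c.2 := .refl hc'.gauss_right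
  obtain ⟨hli, di, hdi, hti, ei⟩ := hi
  obtain ⟨hlj, dj, hdj, htj, ej⟩ := hj
  by_cases hspecial : j = i + 1 ∧ di = dj ∧ H.PhraseHomotopic a.2 (eraseAt (i + 1) a.2)
  · obtain ⟨rfl, rfl, e⟩ := hspecial
    -- In the exceptional case the results already agree. Deleting either of two equal adjacent tags
    -- gives the same list, and once component `i + 1` has been emptied, it makes no difference to
    -- which neighbour it is joined.
    refine ⟨c, .inl ⟨?_, ?_⟩, .inl ⟨rfl, hrefl⟩⟩
    · rw [hb, hc]
      apply List.ext_getElem?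
      intro k
      simp only [List.getElem?_eraseIdx]
      rcases Nat.lt_trichotomy k (i + 1) with h | rfl | h
      · rw [if_pos h, if_pos (by omega)]
      · rw [if_neg (by omega), if_pos (by omega), hti, htj]
      · rw [if_neg (by omega), if_neg (by omega)]
    · have e1 := e.mergeAt i
      have e2 := e.mergeAt (i + 1)
      rw [mergeAt_eq_mergeAt_succ (by rw [length_eraseAt]; omega) (getD_eraseAt_self _ _)] at e1
      exact hb'.symm.trans (e1.trans (e2.symm.trans hc'))
  -- After the join at `i`, the bar that was at `j + 1` has position `j`. The joined components are
  -- adjacent exactly if the new `j` equals `i`.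
  obtain ⟨j, rfl⟩ : ∃ j', j = j' + 1 := ⟨j - 1, by omega⟩
  refine ⟨(b.1.eraseIdx (j + 1), mergeAt j b.2), .inr ⟨j, .congr (a := (a.1.eraseIdx (i + 1),
    mergeAt i a.2)) ⟨?_, dj, hdj, ?_, ?_⟩ hb.symm hb', rfl, .refl (hb'.gauss_right.mergeAt j)⟩,
    .inr ⟨i, .congr (a := (a.1.eraseIdx (j + 1 + 1), mergeAt (j + 1) a.2))
      ⟨?_, di, hdi, ?_, ?_⟩ hc.symm hc', ?_, ?_⟩⟩
  · have := length_mergeAt hli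
    simp only; omega
  · rw [List.getElem?_eraseIdx, if_neg (by omega), htj]
  · by_cases hj : j = i
    · subst hj
      rw [List.getElem?_eraseIdx, if_pos (by omega)]
      rcases ei with ei | ei
      · rcases ej with ej | ej
        · left; rw [ei, ← hti, ej]
        · right
          rw [eraseAt_mergeAt_of_lt (by omega)]
          exact ej.mergeAt j
      · rcases ej with ej | ej
        · exact absurd ⟨rfl, Option.some.inj (hti.symm.trans ej), ei⟩ hspecial
        · right
          rw [eraseAt_mergeAt_of_lt (by omega)]
          exact ej.mergeAt j
    · rw [List.getElem?_eraseIdx, if_neg (by omega)]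
      rcases ej with ej | ej
      · exact .inl ej
      · right
        rw [eraseAt_mergeAt_of_lt (by omega)]
        exact ej.mergeAt i
  · have := length_mergeAt hlj
    simp only; omega
  · rw [List.getElem?_eraseIdx, if_pos (by omega), hti]
  · rw [List.getElem?_eraseIdx, if_pos (by omega)]
    rcases ei with ei | ei
    · exact .inl ei
    · by_cases hj : j = i
      · subst hj
        rcases ej with ej | ej
        · exact absurd ⟨rfl, Option.some.inj (hti.symm.trans ej), ei⟩ hspecial
        · right
          rw [eraseAt_mergeAt_self]
          -- Component `i + 1` has absorbed the next one; it is still reducible because both of its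
          -- parts are.
          refine PhraseHomotopic.mergeAt _ (ej.trans (ei.eraseAt _))
      · right
        rw [eraseAt_mergeAt_of_gt (by omega)]
        exact ei.mergeAt _
  · simp only
    rw [hb, hc, eraseIdx_eraseIdx_succ (by omega)]
  · refine (hc'.symm.mergeAt i).trans ?_
    rw [← mergeAt_mergeAt (by omega)]
    exact hb'.mergeAt j

theorem Rewrites.diamond {a b c : List ℕ × Phrase α} (hb : H.Rewrites a b) (hc : H.Rewrites a c) :
    ∃ d, H.Rewrites b d ∧ H.Rewrites c d := by
  rcases hb with ⟨hb, hb'⟩ | ⟨i, hi, hb, hb'⟩ <;> rcases hc with ⟨hc, hc'⟩ | ⟨j, hj, hc, hc'⟩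
  · exact ⟨c, .inl ⟨hb.symm.trans hc, hb'.symm.trans hc'⟩, .inl ⟨rfl, .refl hc'.gauss_right⟩⟩
  · exact ⟨c, .inr ⟨j, hj.congr hb hb', by rw [hc, hb], (hb'.symm.mergeAt j).trans hc'⟩,
      .inl ⟨rfl, .refl hc'.gauss_right⟩⟩
  · exact ⟨b, .inl ⟨rfl, .refl hb'.gauss_right⟩,
      .inr ⟨i, hi.congr hc hc', by rw [hb, hc], (hc'.symm.mergeAt i).trans hb'⟩⟩
  · rcases Nat.lt_trichotomy i j with h | rfl | h
    · exact diamond_of_lt h hi hb hb' hj hc hc'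
    · exact ⟨c, .inl ⟨hb.trans hc.symm, hb'.symm.trans hc'⟩, .inl ⟨rfl, .refl hc'.gauss_right⟩⟩
    · obtain ⟨d, h1, h2⟩ := diamond_of_lt h hj hc hc' hi hb hb'
      exact ⟨d, h2, h1⟩

/-- No component may be joined to the preceding one. -/
def IsNormal (H : HomotopyDataTriple α) (a : List ℕ × Phrase α) : Prop := ∀ i, ¬ H.CanMerge i a

theorem IsNormal.of_reflTransGen {a b : List ℕ × Phrase α} (ha : H.IsNormal a) (hg : Gauss a.2)
    (h : ReflTransGen H.Rewrites a b) : a.1 = b.1 ∧ H.PhraseHomotopic a.2 b.2 := by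
  induction h with
  | refl => exact ⟨rfl, .refl hg⟩
  | tail _ h ih =>
    rcases h with ⟨h, h'⟩ | ⟨i, hi, _⟩
    · exact ⟨ih.1.trans h, ih.2.trans h'⟩
    · exact absurd (hi.congr ih.1.symm ih.2.symm) (ha i)

/-- Equivalent normal tagged phrases have the same tags and are homotopic. -/
theorem IsNormal.eq_of_eqvGen {a b : List ℕ × Phrase α} (ha : H.IsNormal a) (hb : H.IsNormal b)
    (hga : Gauss a.2) (hgb : Gauss b.2) (h : EqvGen H.Rewrites a b) :
    a.1 = b.1 ∧ H.PhraseHomotopic a.2 b.2 := by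
  -- By the Church–Rosser argument the two phrases rewrite to a common one, and from a normal phrase
  -- only homotopies with fixed tags are possible.
  have hj := equivalence_join_reflTransGen (r := H.Rewrites) fun a b c hb hc =>
    let ⟨d, h1, h2⟩ := Rewrites.diamond hb hc
    ⟨d, .single h1, .single h2⟩
  obtain ⟨c, hac, hbc⟩ := hj.eqvGen_iff.1
    (EqvGen.mono (fun a b h => ⟨b, .single h, .refl⟩) _ _ h)
  obtain ⟨h1, h2⟩ := ha.of_reflTransGen hga hac
  obtain ⟨h3, h4⟩ := hb.of_reflTransGen hgb hbc
  exact ⟨h1.trans h3.symm, h2.trans h4.symm⟩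

/-- Forget the bars whose tags are not `0`. -/
def forget (a : List ℕ × Phrase α) : Phrase α :=
  (removeBars (fun k => decide (a.1.getD k 0 ≠ 0)) 0 a.2).2

/-- Only soft bars are ever joined over, and these are forgotten in any case. -/
theorem forget_merge {a : List ℕ × Phrase α} {i : ℕ} (h : H.CanMerge i a) :
    forget (a.1.eraseIdx (i + 1), mergeAt i a.2) = forget a := by
  obtain ⟨hl, d, hd, h1, _⟩ := h
  unfold forget
  rw [removeBars_mergeAt hl (s := fun k => decide (a.1.getD k 0 ≠ 0))]
  · simp [List.getD_eq_getElem?_getD, h1, hd]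
  · intro j hj
    simp only [List.getD_eq_getElem?_getD, List.getElem?_eraseIdx, if_pos (show j < i + 1 by omega)]
  · intro j hj
    simp only [List.getD_eq_getElem?_getD, List.getElem?_eraseIdx,
      if_neg (show ¬ j < i + 1 by omega)]

/-- A first tag `0` keeps the leading bar, so no letters are lost in front of it. The equivalence of
Gauss conditions is carried along because `EqvGen` is reflexive on arbitrary tagged phrases. -/
theorem phraseHomotopic_forget {a b : List ℕ × Phrase α} (h : EqvGen H.Rewrites a b) :
    a.1.getD 0 0 = b.1.getD 0 0 ∧ (Gauss a.2 ↔ Gauss b.2) ∧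
      (a.1.getD 0 0 = 0 → Gauss a.2 → H.PhraseHomotopic (forget a) (forget b)) := by
  induction h with
  | rel a b h =>
    rcases h with ⟨h, h'⟩ | ⟨i, hi, h, h'⟩
    · refine ⟨by rw [h], ⟨fun _ => h'.gauss_right, fun _ => h'.gauss_left⟩, fun h0 _ => ?_⟩
      unfold forget
      rw [← h]
      exact h'.removeBars (by simp only [h0]; rfl)
    · have hg : Gauss a.2 := (Gauss.of_perm (by rw [flatten_mergeAt])).1 h'.gauss_left
      have h0 : b.1.getD 0 0 = a.1.getD 0 0 := by
        simp only [h, List.getD_eq_getElem?_getD, List.getElem?_eraseIdx]; simp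
      refine ⟨h0.symm, ⟨fun _ => h'.gauss_right, fun _ => hg⟩, fun h1 _ => ?_⟩
      rw [← forget_merge hi, ← h]
      unfold forget
      exact h'.removeBars (by simp only [h0, h1]; rfl)
  | refl a =>
    exact ⟨rfl, Iff.rfl, fun h hg => .refl (hg.removeBars (by simp only [h]; rfl))⟩
  | symm a b _ ih =>
    exact ⟨ih.1.symm, ih.2.1.symm, fun h hg => (ih.2.2 (ih.1.trans h) (ih.2.1.2 hg)).symm⟩
  | trans a b c _ _ ih ih' =>
    exact ⟨ih.1.trans ih'.1, ih.2.1.trans ih'.2.1, fun h hg =>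
      (ih.2.2 h hg).trans (ih'.2.2 (ih.1.symm.trans h) (ih.2.1.1 hg))⟩

end HomotopyDataTriple

/-! ### Marked sequences and the refinement of a phrase -/

namespace Phrase

variable {α : Type*}

/-- The marks in a sequence of marks and letters. -/
def marks {β : Type*} : List (ℕ ⊕ β) → List ℕ
  | [] => []
  | .inl d :: S => d :: marks S
  | .inr _ :: S => marks S

/-- Replace every mark by a bar. -/
def unmark {β : Type*} (S : List (ℕ ⊕ β)) : List (Option β) := S.map (Sum.elim (fun _ => none) some)

/-- The tagged phrase described by a sequence of marks and letters: every component is preceded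
by its tag. -/
def tagged {β : Type*} (S : List (ℕ ⊕ β)) : List ℕ × List (List β) :=
  (marks S, (parse (unmark S)).2)

/-- Make every letter a component of its own, whose tag is given by `c`; the original bars
become empty components with tag `0`. -/
def refine (c : α → ℕ) : List (Option (Letter α)) → List (ℕ ⊕ Letter α)
  | [] => []
  | none :: T => .inl 0 :: refine c T
  | some X :: T => .inl (c X.2) :: .inr X :: refine c T

section

variable {β : Type*}

@[simp] theorem marks_append (x y : List (ℕ ⊕ β)) : marks (x ++ y) = marks x ++ marks y := by
  induction x with
  | nil => simp [marks]
  | cons a x ih => cases a <;> simp [marks, ih]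

@[simp] theorem marks_map_inr (w : List β) : marks (w.map Sum.inr) = [] := by
  induction w with
  | nil => simp [marks]
  | cons a x ih => simp [marks, ih]

@[simp] theorem unmark_nil : unmark ([] : List (ℕ ⊕ β)) = [] := rfl

@[simp] theorem unmark_inl (d : ℕ) (S : List (ℕ ⊕ β)) : unmark (.inl d :: S) = none :: unmark S :=
  rfl

@[simp] theorem unmark_inr (X : β) (S : List (ℕ ⊕ β)) : unmark (.inr X :: S) = some X :: unmark S :=
  rfl

@[simp] theorem unmark_append (x y : List (ℕ ⊕ β)) : unmark (x ++ y) = unmark x ++ unmark y := by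
  simp [unmark]

@[simp] theorem refine_append (c : α → ℕ) (x y : List (Option (Letter α))) :
    refine c (x ++ y) = refine c x ++ refine c y := by
  induction x with
  | nil => simp [refine]
  | cons a x ih => cases a <;> simp [refine, ih]

@[simp] theorem letters_unmark_refine (c : α → ℕ) (x : List (Option (Letter α))) :
    letters (unmark (refine c x)) = letters x := by
  induction x with
  | nil => simp [refine, letters]
  | cons a x ih => cases a <;> simp [refine, ih, letters]

theorem length_marks (S : List (ℕ ⊕ β)) : (marks S).length = bars (unmark S) := by
  induction S with
  | nil => simp [marks, bars]
  | cons a S ih => cases a <;> simp [marks, bars, ih]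

theorem length_parse (T : List (Option β)) : (parse T).2.length = bars T := by
  induction T with
  | nil => simp [parse, bars]
  | cons a S ih => cases a <;> simp [parse, bars, ih]

theorem parse_append_fst {x : List (Option β)} (h : bars x ≠ 0) (y z : List (Option β)) :
    (parse (x ++ y)).1 = (parse (x ++ z)).1 := by
  induction x with
  | nil => simp [bars] at h
  | cons a x ih => cases a <;> simp_all [parse, bars]

theorem parse_append_none {x : List (Option β)} (h : bars x = 0) (y : List (Option β)) :
    parse (x ++ y) = ((parse x).1 ++ (parse y).1, (parse y).2) ∧
      parse (x ++ none :: y) = ((parse x).1, (parse y).1 :: (parse y).2) := by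
  induction x with
  | nil => simp [parse]
  | cons a x ih =>
    cases a with
    | none => simp [bars] at h
    | some X => simp [parse, ih (by simpa [bars] using h)]

/-- Here `bars x = i + 1` says that the deleted bar is the one between components `i` and `i + 1`.
-/
theorem mergeAt_parse {i : ℕ} {x : List (Option β)} (h : bars x = i + 1) (y : List (Option β)) :
    mergeAt i (parse (x ++ none :: y)).2 = (parse (x ++ y)).2 := by
  induction x generalizing i with
  | nil => simp [bars] at h
  | cons a x ih =>
    cases a with
    | some X => simpa [parse] using ih (by simpa [bars] using h)
    | none =>
      simp only [bars, Nat.add_right_cancel_iff] at h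
      cases i with
      | zero =>
        obtain ⟨h1, h2⟩ := parse_append_none h y
        simp [parse, h1, h2, mergeAt]
      | succ i =>
        simp only [List.cons_append, parse, mergeAt, ih h]
        rw [parse_append_fst (by omega)]

theorem getD_parse (x y : List (Option β)) :
    (parse (x ++ none :: y)).2.getD (bars x) [] = (parse y).1 := by
  induction x with
  | nil => simp [parse, bars]
  | cons a x ih => cases a <;> simpa [parse, bars] using ih

theorem beginsWithBar_refine (c : α → ℕ) (T : List (Option (Letter α))) :
    (parse (unmark (refine c T))).1 = [] := by
  cases T with
  | nil => simp [refine, parse]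
  | cons a T => cases a <;> simp [refine, parse]

/-- Replace the marks `0` by bars, and delete the others. -/
def hardBars : List (ℕ ⊕ β) → List (Option β)
  | [] => []
  | .inl d :: S => if d = 0 then none :: hardBars S else hardBars S
  | .inr X :: S => some X :: hardBars S

theorem process_unmark {b : ℕ → List (Option β)} {k : ℕ} {S : List (ℕ ⊕ β)}
    (h : ∀ j, b (k + j) = if (marks S).getD j 0 ≠ 0 then [] else [none]) :
    process b some k (unmark S) = hardBars S := by
  induction S generalizing k with
  | nil => simp [process, hardBars]
  | cons a S ih =>
    cases a with
    | inr X => simp [process, hardBars, ih (k := k) h]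
    | inl d =>
      have h0 := h 0
      have := ih (k := k + 1) fun j => by
        rw [Nat.add_assoc, Nat.add_comm 1, h]; simp [marks]
      simp only [marks, Nat.add_zero, List.getD_cons_zero] at h0
      by_cases hd : d = 0 <;> simp [process, hardBars, this, h0, hd]

theorem hardBars_refine {c : α → ℕ} (hc : ∀ a, c a ≠ 0) (T : List (Option (Letter α))) :
    hardBars (refine c T) = T := by
  induction T with
  | nil => simp [refine, hardBars]
  | cons a T ih => cases a <;> simp [refine, hardBars, ih, hc]

theorem lead_map {γ : Type*} (f : β → γ) (l : List (List β)) :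
    lead (l.map (List.map f)) = (lead l).map (Option.map f) := by
  induction l with
  | nil => simp [lead]
  | cons w l ih => simp [lead, ih, Function.comp_def]

theorem parse_map {γ : Type*} (f : β → γ) (T : List (Option β)) :
    parse (T.map (Option.map f)) = ((parse T).1.map f, (parse T).2.map (List.map f)) := by
  induction T with
  | nil => simp [parse]
  | cons a T ih => cases a <;> simp [parse, ih]

theorem refine_map {c : α → ℕ} {f : Letter α → Letter α} {T : List (Option (Letter α))}
    (h : ∀ X ∈ letters T, (f X).2 = X.2) :
    marks (refine c (T.map (Option.map f))) = marks (refine c T) ∧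
      unmark (refine c (T.map (Option.map f))) = (unmark (refine c T)).map (Option.map f) := by
  induction T with
  | nil => simp [refine]
  | cons a T ih =>
    cases a with
    | none => simpa [refine, marks, letters] using ih h
    | some X =>
      simp only [letters, List.mem_cons, forall_eq_or_imp] at h
      simpa [refine, marks, h.1] using ih h.2

theorem flatten_parse {T : List (Option β)} (h : BeginsWithBar T) :
    (parse T).2.flatten = letters T := by
  rw [← letters_lead, lead_parse h]

end

end Phrase

/-! ### Homotopy as equivalence under rewriting -/

namespace HomotopyDataTriple

open Phrase Relation

variable {α : Type*} {H : HomotopyDataTriple α} {c : α → ℕ}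

theorem rewrites_of_same_tag {x y : List (ℕ ⊕ Letter α)} {w : List (Letter α)} {d : ℕ}
    (hd : d ≠ 0) (hg : Gauss (tagged (x ++ .inl d :: (w.map .inr ++ y))).2) :
    H.Rewrites (tagged (x ++ .inl d :: (w.map .inr ++ .inl d :: y)))
      (tagged (x ++ .inl d :: (w.map .inr ++ y))) := by
  have hb : bars (unmark (x ++ .inl d :: w.map .inr)) = (marks x).length + 1 := by
    rw [← length_marks]; simp [marks]
  have e1 : x ++ .inl d :: (w.map .inr ++ .inl d :: y) =
      (x ++ .inl d :: w.map .inr) ++ .inl d :: y := by simp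
  have e2 : x ++ .inl d :: (w.map .inr ++ y) = (x ++ .inl d :: w.map .inr) ++ y := by simp
  rw [e2] at hg
  rw [e1, e2]
  refine .inr ⟨(marks x).length, ⟨?_, d, hd, ?_, .inl ?_⟩, ?_, ?_⟩
  · simp only [tagged, length_parse, unmark_append, bars_append] at hb ⊢
    rw [hb]
    simp [bars]
  · simp [tagged, marks]
  · simp [tagged, marks]
  · simp [tagged, marks, List.eraseIdx_append_of_length_le]
  · simp only [tagged, unmark_append (x ++ .inl d :: w.map .inr), unmark_inl] at hg ⊢
    rw [mergeAt_parse hb]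
    exact .refl hg

/-- The rest `y` has no letters before its first bar, so the component marked `d` is empty and
trivially reducible. The mark `0` in front guarantees a component to which it can be joined. -/
theorem rewrites_of_empty {x y : List (ℕ ⊕ Letter α)} {d : ℕ} (hd : d ≠ 0)
    (hy : (parse (unmark y)).1 = []) (hg : Gauss (tagged (.inl 0 :: x ++ y)).2) :
    H.Rewrites (tagged (.inl 0 :: x ++ .inl d :: y)) (tagged (.inl 0 :: x ++ y)) := by
  have hb : bars (unmark (.inl 0 :: x)) = (marks x).length + 1 := by
    rw [← length_marks]; simp [marks]
  have hm : mergeAt (marks x).length (tagged (.inl 0 :: x ++ .inl d :: y)).2 =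
      (tagged (.inl 0 :: x ++ y)).2 := by
    simp only [tagged, unmark_append (.inl 0 :: x), unmark_inl d]
    exact mergeAt_parse hb _
  refine .inr ⟨(marks x).length, ⟨?_, d, hd, ?_, .inr ?_⟩, ?_, ?_⟩
  · simp only [tagged, length_parse, unmark_append (.inl 0 :: x), bars_append]
    rw [hb]
    simp [bars]
  · simp [tagged, marks]
  · rw [eraseAt_eq_self]
    · refine .refl ((Gauss.of_perm ?_).2 hg)
      rw [← hm, flatten_mergeAt]
    · rw [← hb]
      simp only [tagged, unmark_append (.inl 0 :: x), unmark_inl d]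
      rw [getD_parse, hy]
  · simp [tagged, marks, List.eraseIdx_append_of_length_le]
  · rw [hm]
    exact .refl hg

open Classical in
theorem gauss_tagged {S : List (ℕ ⊕ Letter α)} {T : List (Option (Letter α))} {l : Phrase α}
    (hl : Gauss l) (hT : lead l = T) (hS : (letters (unmark (.inl 0 :: S))).Perm (letters T)) :
    Gauss (tagged (.inl 0 :: S)).2 := by
  refine (Gauss.of_perm (l' := l) ?_).2 hl
  rw [← letters_lead l, hT]
  refine List.Perm.trans ?_ hS
  rw [tagged, flatten_parse]
  simp [BeginsWithBar, parse]

theorem rewrites_of_move {S S' : List (ℕ ⊕ Letter α)} (hm : marks S = marks S')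
    (hg : Gauss (tagged (.inl 0 :: S)).2) (hg' : Gauss (tagged (.inl 0 :: S')).2)
    (h : H.TokenMove (unmark (.inl 0 :: S)) (unmark (.inl 0 :: S'))) :
    H.Rewrites (tagged (.inl 0 :: S)) (tagged (.inl 0 :: S')) := by
  refine .inl ⟨by simp [tagged, marks, hm], .of_move hg hg' ?_⟩
  rw [tagged, tagged, lead_parse (by simp [BeginsWithBar, parse]),
    lead_parse (by simp [BeginsWithBar, parse])]
  exact h

theorem exists_cons_of_lead {l : Phrase α} {x y : List (Option (Letter α))} {A : Letter α}
    (h : lead l = x ++ some A :: y) : ∃ x', x = none :: x' := by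
  cases l with
  | nil => simp [lead] at h
  | cons w l =>
    cases x with
    | nil => simp [lead] at h
    | cons a x =>
      simp only [lead, List.cons_append, List.cons.injEq] at h
      exact ⟨x, by rw [← h.1]⟩

/-- `c` distinguishes unions of factors, and does not take the value `0`. -/
structure IsColouring (H : HomotopyDataTriple α) (c : α → ℕ) : Prop where
  ne_zero : ∀ a, c a ≠ 0
  map_τ : ∀ a, c (H.τ a) = c a
  mem_S : ∀ x y z, (x, y, z) ∈ H.S → c x = c y ∧ c x = c z

/-- All letters of a move have the same colour. The soft bars inside its pairs can therefore be
removed, the move applied, and the soft bars before the pairs removed as empty components (H1, H2)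
or the inner bars restored (H3). -/
theorem eqvGen_of_move (hc : H.IsColouring c) {l l' : Phrase α} (hl : Gauss l) (hl' : Gauss l')
    (h : H.TokenMove (lead l) (lead l')) :
    EqvGen H.Rewrites (tagged (refine c (lead l))) (tagged (refine c (lead l'))) := by
  generalize hT : lead l = T at h
  generalize hT' : lead l' = T' at h
  cases h with
  | h1 A x y =>
    obtain ⟨x, rfl⟩ := exists_cons_of_lead (hT.trans (List.append_assoc ..))
    have hd := hc.ne_zero A.2
    simp only [refine_append, refine, List.cons_append, List.append_assoc, List.nil_append]
    set d := c A.2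
    set X := refine c x with hX
    set Y := refine c y with hY
    -- With `|` for a soft bar: `X|A|AY`, then `X|AAY`, then `X|Y`, then `XY`.
    refine .trans _ (tagged (.inl 0 :: (X ++ .inl d :: .inr A :: .inr A :: Y))) _ (.rel _ _ ?_)
      (.trans _ (tagged (.inl 0 :: (X ++ .inl d :: Y))) _ (.rel _ _ ?_) (.rel _ _ ?_))
    · refine rewrites_of_same_tag (x := .inl 0 :: X) (w := [A]) (y := .inr A :: Y) hd ?_
      exact gauss_tagged hl hT (by simp [letters, hX, hY])
    · refine rewrites_of_move (by simp [marks]) (gauss_tagged hl hT (by simp [letters, hX, hY]))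
        (gauss_tagged hl' hT' (by simp [letters, hX, hY])) ?_
      have := TokenMove.h1 (H := H) A (none :: (unmark X ++ [none])) (unmark Y)
      simp only [List.append_assoc, List.cons_append, List.nil_append, unmark_append, unmark_inl,
        unmark_inr] at this ⊢
      exact this
    · exact rewrites_of_empty hd (beginsWithBar_refine _ _)
        (gauss_tagged hl' hT' (by simp [letters, hX, hY]))
  | h2 A B x y z h =>
    obtain ⟨x, rfl⟩ := exists_cons_of_lead (hT.trans (by simp; rfl))
    have hd := hc.ne_zero A.2
    have hB : c B.2 = c A.2 := by rw [← h, hc.map_τ]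
    simp only [refine_append, refine, List.cons_append, List.append_assoc, List.nil_append, hB]
    set d := c A.2
    set X := refine c x with hX
    set Y := refine c y with hY
    set Z := refine c z with hZ
    -- With `|` for a soft bar: `X|A|BY|B|AZ`, `X|ABY|B|AZ`, `X|ABY|BAZ`, `X|Y|Z`, `XY|Z`, `XYZ`.
    refine .trans _ (tagged (.inl 0 :: (X ++ .inl d :: .inr A :: .inr B :: (Y ++ .inl d :: .inr B ::
      .inl d :: .inr A :: Z)))) _ (.rel _ _ ?_)
      (.trans _ (tagged (.inl 0 :: (X ++ .inl d :: .inr A :: .inr B :: (Y ++ .inl d :: .inr B ::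
        .inr A :: Z)))) _ (.rel _ _ ?_)
      (.trans _ (tagged (.inl 0 :: (X ++ .inl d :: (Y ++ .inl d :: Z)))) _ (.rel _ _ ?_)
      (.trans _ (tagged (.inl 0 :: (X ++ (Y ++ .inl d :: Z)))) _ (.rel _ _ ?_) (.rel _ _ ?_))))
    · refine rewrites_of_same_tag (x := .inl 0 :: X) (w := [A]) (y := .inr B :: (Y ++ .inl d ::
        .inr B :: .inl d :: .inr A :: Z)) hd ?_
      exact gauss_tagged hl hT (by simp [letters, hX, hY, hZ])
    · have := rewrites_of_same_tag (H := H) (x := .inl 0 :: (X ++ .inl d :: .inr A :: .inr B :: Y))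
        (w := [B]) (y := .inr A :: Z) hd
      simp only [List.cons_append, List.append_assoc, List.map_cons, List.map_nil,
        List.nil_append] at this
      exact this (gauss_tagged hl hT (by simp [letters, hX, hY, hZ]))
    · refine rewrites_of_move (by simp [marks]) (gauss_tagged hl hT (by simp [letters, hX, hY, hZ]))
        (gauss_tagged hl' hT' (by simp [letters, hX, hY, hZ])) ?_
      have := TokenMove.h2 (H := H) A B (none :: (unmark X ++ [none])) (unmark Y ++ [none])
        (unmark Z) h
      simp only [List.append_assoc, List.cons_append, List.nil_append, unmark_append, unmark_inl,
        unmark_inr] at this ⊢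
      exact this
    · refine rewrites_of_empty (x := X) (y := Y ++ .inl d :: Z) hd ?_
        (gauss_tagged hl' hT' (by simp [letters, hX, hY, hZ]))
      cases y with
      | nil => simp [hY, refine, parse]
      | cons a y => cases a <;> simp [hY, refine, parse]
    · have := rewrites_of_empty (H := H) (x := X ++ Y) (y := Z) hd (beginsWithBar_refine _ _)
      simp only [List.cons_append, List.append_assoc] at this
      exact this (gauss_tagged hl' hT' (by simp [letters, hX, hY, hZ]))
  | h3 A B C x y z t h =>
    obtain ⟨x, rfl⟩ := exists_cons_of_lead (hT.trans (by simp; rfl))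
    have hd := hc.ne_zero A.2
    obtain ⟨hB, hC⟩ := hc.mem_S _ _ _ h
    simp only [refine_append, refine, List.cons_append, List.append_assoc, List.nil_append, ← hB,
      ← hC]
    set d := c A.2
    set X := refine c x with hX
    set Y := refine c y with hY
    set Z := refine c z with hZ
    set W := refine c t with hW
    -- Both sides of H3 have three pairs of one colour; `key` removes the soft bar inside each pair,
    -- and is used forwards for `l` and backwards for `l'`.
    have key : ∀ (l : Phrase α) (A A' B B' C C' : Letter α), Gauss l →
        lead l = none :: x ++ [some A, some A'] ++ y ++ [some B, some B'] ++ z ++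
          [some C, some C'] ++ t →
        Gauss (tagged (.inl 0 :: (X ++ .inl d :: .inr A :: .inr A' :: (Y ++ .inl d ::
          .inr B :: .inr B' :: (Z ++ .inl d :: .inr C :: .inr C' :: W))))).2 ∧
        EqvGen H.Rewrites (tagged (.inl 0 :: (X ++ .inl d :: .inr A :: .inl d :: .inr A' ::
          (Y ++ .inl d :: .inr B :: .inl d :: .inr B' :: (Z ++ .inl d :: .inr C :: .inl d ::
            .inr C' :: W)))))
          (tagged (.inl 0 :: (X ++ .inl d :: .inr A :: .inr A' :: (Y ++ .inl d ::
          .inr B :: .inr B' :: (Z ++ .inl d :: .inr C :: .inr C' :: W))))) := by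
      intro l A A' B B' C C' hl hT
      refine ⟨gauss_tagged hl hT (by simp [letters, hX, hY, hZ, hW]), ?_⟩
      have s1 := rewrites_of_same_tag (H := H) (x := .inl 0 :: X) (w := [A]) (y := .inr A' ::
        (Y ++ .inl d :: .inr B :: .inl d :: .inr B' :: (Z ++ .inl d :: .inr C :: .inl d ::
            .inr C' :: W))) hd
      have s2 := rewrites_of_same_tag (H := H) (x := .inl 0 :: (X ++ .inl d :: .inr A :: .inr A' ::
        Y)) (w := [B]) (y := .inr B' :: (Z ++ .inl d :: .inr C :: .inl d :: .inr C' :: W)) hd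
      have s3 := rewrites_of_same_tag (H := H) (x := .inl 0 :: (X ++ .inl d :: .inr A :: .inr A' ::
        (Y ++ .inl d :: .inr B :: .inr B' :: Z))) (w := [C]) (y := .inr C' :: W) hd
      simp only [List.cons_append, List.append_assoc, List.map_cons, List.map_nil,
        List.nil_append] at s1 s2 s3
      exact .trans _ _ _ (.rel _ _ (s1 (gauss_tagged hl hT (by simp [letters, hX, hY, hZ, hW]))))
        (.trans _ _ _ (.rel _ _ (s2 (gauss_tagged hl hT (by simp [letters, hX, hY, hZ, hW]))))
        (.rel _ _ (s3 (gauss_tagged hl hT (by simp [letters, hX, hY, hZ, hW])))))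
    obtain ⟨g, e⟩ := key l A B A C B C hl hT
    obtain ⟨g', e'⟩ := key l' B A C A C B hl' hT'
    refine .trans _ _ _ e (.trans _ _ _ (.rel _ _ ?_) (.symm _ _ e'))
    refine rewrites_of_move (by simp [marks]) g g' ?_
    have := TokenMove.h3 (H := H) A B C (none :: (unmark X ++ [none])) (unmark Y ++ [none])
      (unmark Z ++ [none]) (unmark W) h
    simp only [List.append_assoc, List.cons_append, List.nil_append, unmark_append, unmark_inl,
      unmark_inr] at this ⊢
    exact this

theorem beginsWithBar_refine_lead (c : α → ℕ) (l : Phrase α) :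
    BeginsWithBar (unmark (refine c (lead l))) := beginsWithBar_refine c _

theorem gauss_refine {l : Phrase α} (c : α → ℕ) :
    Gauss (tagged (refine c (lead l))).2 ↔ Gauss l := by
  apply Gauss.of_perm
  rw [tagged, flatten_parse (beginsWithBar_refine_lead c l)]
  simp

theorem forget_refine (hc : H.IsColouring c) (l : Phrase α) :
    forget (tagged (refine c (lead l))) = l := by
  apply lead_injective
  unfold forget
  rw [lead_removeBars_snd, tagged, lead_parse (beginsWithBar_refine_lead c l), process_unmark,
    hardBars_refine hc.ne_zero]
  · intro j; simp
  · cases l <;> simp [tagged, refine, lead, marks]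

/-- Renamings and moves lift to the refinement; conversely, forgetting the soft bars recovers the
phrase and turns rewriting into homotopy. -/
theorem phraseHomotopic_iff_eqvGen (hc : H.IsColouring c) {l l' : Phrase α} (hl : Gauss l) :
    H.PhraseHomotopic l l' ↔
      EqvGen H.Rewrites (tagged (refine c (lead l))) (tagged (refine c (lead l'))) := by
  constructor
  · rintro ⟨hl, hl', h⟩
    suffices ∀ p q : Nanophrase α, H.Homotopic p q → EqvGen H.Rewrites
      (tagged (refine c (lead p.components))) (tagged (refine c (lead q.components))) from
      this _ _ h
    intro p q h
    induction h with
    | rel p q h =>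
      rcases h with ⟨f, hf, hproj, hq⟩ | h
      · have hp := p.gauss
        have hq' := q.gauss
        refine .rel _ _ (.inl ?_)
        rw [hq] at hq' ⊢
        obtain ⟨e1, e2⟩ := refine_map (c := c) (f := f) (T := lead p.components)
          (by rw [letters_lead]; exact hproj)
        have hg := (gauss_refine c).2 hq'
        simp only [tagged, lead_map, e1, e2, parse_map, true_and] at hg ⊢
        refine .of_renaming ((gauss_refine c).2 hp) hg ⟨?_, ?_⟩
        · rw [flatten_parse (beginsWithBar_refine_lead c _), letters_unmark_refine, letters_lead]
          exact hf.injOn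
        · rw [flatten_parse (beginsWithBar_refine_lead c _), letters_unmark_refine, letters_lead]
          exact hproj
      · exact eqvGen_of_move hc p.gauss q.gauss (tokenMove_lead_iff.2 h)
    | refl p => exact .refl _
    | symm p q _ ih => exact .symm _ _ ih
    | trans p q r _ _ ih ih' => exact .trans _ _ _ ih ih'
  · intro h
    have := (phraseHomotopic_forget h).2.2 ?_ ((gauss_refine c).2 hl)
    · rwa [forget_refine hc, forget_refine hc] at this
    · cases l <;> simp [tagged, refine, lead, marks]

end HomotopyDataTriple

/-! ### Computability of the operations and of normalization -/

namespace Phrase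

theorem mergeAt_eq_ite {β : Type*} (i : ℕ) (l : List (List β)) :
    mergeAt i l = if i + 1 < l.length then
      l.take i ++ ((l.getD i [] ++ l.getD (i + 1) []) :: l.drop (i + 2)) else l := by
  induction l generalizing i with
  | nil => cases i <;> simp [mergeAt]
  | cons u l ih =>
    cases i with
    | zero => cases l <;> simp [mergeAt]
    | succ i =>
      simp only [mergeAt, ih i]
      by_cases h : i + 1 < l.length <;> simp [h]

section Primrec

variable {β : Type*} [Primcodable β]

theorem primrec_mergeAt : Primrec₂ (mergeAt : ℕ → List (List β) → List (List β)) := by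
  have hi : Primrec fun x : ℕ × List (List β) => x.1 := Primrec.fst
  have hl : Primrec fun x : ℕ × List (List β) => x.2 := Primrec.snd
  have hs : Primrec fun x : ℕ × List (List β) => x.1 + 1 := Primrec.succ.comp hi
  have hss : Primrec fun x : ℕ × List (List β) => x.1 + 2 := Primrec.succ.comp hs
  refine Primrec.of_eq (f := fun x : ℕ × List (List β) => if x.1 + 1 < x.2.length then
      x.2.take x.1 ++ ((x.2.getD x.1 [] ++ x.2.getD (x.1 + 1) []) :: x.2.drop (x.1 + 2)) else x.2)
    ?_ fun x => (mergeAt_eq_ite _ _).symm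
  refine Primrec.ite (Primrec.nat_lt.comp hs (Primrec.list_length.comp hl))
    (Primrec.list_append.comp (Primrec.list_take.comp hi hl)
      (Primrec.list_cons.comp (Primrec.list_append.comp ((Primrec.list_getD []).comp hl hi)
        ((Primrec.list_getD []).comp hl hs)) (Primrec.list_drop.comp hss hl))) hl

theorem primrec_eraseIdx : Primrec₂ (List.eraseIdx : List β → ℕ → List β) :=
  Primrec.of_eq (f := fun x : List β × ℕ => x.1.take x.2 ++ x.1.drop (x.2 + 1))
    (Primrec.list_append.comp (Primrec.list_take.comp Primrec.snd Primrec.fst)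
      (Primrec.list_drop.comp (Primrec.succ.comp Primrec.snd) Primrec.fst))
    fun _ => (List.eraseIdx_eq_take_drop_succ ..).symm

/-- `eraseAt` for letters with decidable equality. -/
def eraseLettersAt [DecidableEq β] (i : ℕ) (l : List (List β)) : List (List β) :=
  l.map (List.filter fun X => X ∉ l.getD i [])

theorem primrec_eraseLettersAt [DecidableEq β] :
    Primrec₂ (eraseLettersAt : ℕ → List (List β) → List (List β)) := by
  have hmem : PrimrecRel fun (v : List β) (X : β) => ∃ Y ∈ v, Y = X :=
    PrimrecRel.exists_mem_list (R := fun Y X : β => Y = X) Primrec.eq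
  have hin : Primrec₂ fun (x : ℕ × List (List β)) (w : List β) =>
      w.flatMap fun X => if ∃ Y ∈ x.2.getD x.1 [], Y = X then [] else [X] := by
    refine Primrec.list_flatMap Primrec.snd (Primrec.ite ?_ (Primrec.const []) ?_)
    · refine hmem.comp ((Primrec.list_getD []).comp (Primrec.snd.comp (Primrec.fst.comp Primrec.fst))
        (Primrec.fst.comp (Primrec.fst.comp Primrec.fst))) Primrec.snd
    · exact Primrec.list_cons.comp Primrec.snd (Primrec.const [])
  refine (Primrec.list_map Primrec.snd hin).of_eq fun x => ?_
  simp only [eraseLettersAt]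
  apply List.map_congr_left
  intro w hw
  clear hw
  induction w with
  | nil => simp
  | cons X w ih =>
    rw [List.flatMap_cons, ih]
    by_cases h : X ∈ x.2.getD x.1 [] <;> simp_all

end Primrec

/-- `proj` on codes: a letter with projection `k` gets the projection `m` if the `k`th entry of
the table is `some m`, and is deleted if it is `none`. -/
def projCode (T : List (Option ℕ)) (l : List (List (ℕ × ℕ))) : List (List (ℕ × ℕ)) :=
  l.map (List.filterMap fun X => (T.getD X.2 none).map (Prod.mk X.1))

theorem primrec_projCode (T : List (Option ℕ)) : Primrec (projCode T) := by
  have h : Primrec fun X : ℕ × ℕ => (T.getD X.2 none).map (Prod.mk X.1) :=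
    Primrec.option_map ((Primrec.list_getD none).comp (Primrec.const T) Primrec.snd)
      (Primrec.pair (Primrec.fst.comp Primrec.fst) Primrec.snd)
  exact Primrec.list_map Primrec.id (Primrec.listFilterMap Primrec.snd (h.comp Primrec.snd))

/-- The code of the tagged phrase in which every letter is a component of its own, where the
table gives the tags. -/
def refineCode (T : List ℕ) (l : List (List (ℕ × ℕ))) : List ℕ × List (List (ℕ × ℕ)) :=
  (l.flatMap fun w => 0 :: w.map fun X => T.getD X.2 0, l.flatMap fun w => [] :: w.map fun X => [X])

theorem primrec_refineCode (T : List ℕ) : Primrec (refineCode T) := by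
  have h : Primrec fun X : ℕ × ℕ => T.getD X.2 0 :=
    (Primrec.list_getD 0).comp (Primrec.const T) Primrec.snd
  have h' : Primrec fun X : ℕ × ℕ => [X] := Primrec.list_cons.comp Primrec.id (Primrec.const [])
  refine Primrec.pair (Primrec.list_flatMap Primrec.id ?_) (Primrec.list_flatMap Primrec.id ?_)
  · exact Primrec.list_cons.comp (Primrec.const 0)
      (Primrec.list_map Primrec.snd (h.comp Primrec.snd))
  · exact Primrec.list_cons.comp (Primrec.const [])
      (Primrec.list_map Primrec.snd (h'.comp Primrec.snd))

section Normalize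

variable {σ : Type*}

/-- Apply `step i` for all `i < n` in turn. -/
def pass (step : ℕ → σ → σ) (n : ℕ) (s : σ) : σ :=
  Nat.rec (motive := fun _ => σ) s (fun i a => step i a) n

/-- Repeat the passes as often as the size of the argument says. -/
def normalize (step : ℕ → σ → σ) (size : σ → ℕ) (s : σ) : σ :=
  Nat.rec (motive := fun _ => σ) s (fun _ a => pass step (size a) a) (size s)

theorem computable_normalize [Primcodable σ] {step : ℕ → σ → σ} {size : σ → ℕ}
    (hstep : Computable₂ step) (hsize : Computable size) : Computable (normalize step size) := by
  have hp : Computable fun s => pass step (size s) s :=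
    Computable.nat_rec (h := fun _ (x : ℕ × σ) => step x.1 x.2) hsize Computable.id
      (hstep.comp (Computable.fst.comp Computable.snd) (Computable.snd.comp Computable.snd))
  exact Computable.nat_rec (h := fun _ (x : ℕ × σ) => pass step (size x.2) x.2) hsize Computable.id
    (hp.comp (Computable.snd.comp Computable.snd))

variable {step : ℕ → σ → σ} {size : σ → ℕ} {P : σ → Prop} {bad : ℕ → σ → Prop}

/-- A pass that meets no bad index leaves its argument unchanged; any other pass makes it smaller.
Badness in the second alternative refers to the argument before the pass, because the first step
that acts still sees that argument. -/
theorem pass_spec (hgood : ∀ i s, P s → ¬ bad i s → step i s = s)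
    (hbad : ∀ i s, P s → bad i s → P (step i s) ∧ size (step i s) < size s) (n : ℕ) {s : σ}
    (hs : P s) : P (pass step n s) ∧ ((pass step n s = s ∧ ∀ i < n, ¬ bad i s) ∨
      size (pass step n s) < size s ∧ ∃ i < n, bad i s) := by
  induction n with
  | zero => exact ⟨hs, .inl ⟨rfl, fun i hi => absurd hi (Nat.not_lt_zero i)⟩⟩
  | succ n ih =>
    obtain ⟨h1, h2⟩ := ih
    have e : pass step (n + 1) s = step n (pass step n s) := rfl
    rw [e]
    by_cases hb : bad n (pass step n s)
    · obtain ⟨h3, h4⟩ := hbad n _ h1 hb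
      refine ⟨h3, .inr ?_⟩
      rcases h2 with ⟨h2, -⟩ | ⟨h2, i, hi, hbi⟩
      · rw [h2] at h4 hb ⊢
        exact ⟨h4, n, Nat.lt_succ_self n, hb⟩
      · exact ⟨h4.trans h2, i, hi.trans (Nat.lt_succ_self n), hbi⟩
    · rw [hgood n _ h1 hb]
      refine ⟨h1, ?_⟩
      rcases h2 with ⟨h2, h3⟩ | ⟨h2, i, hi, hbi⟩
      · refine .inl ⟨h2, fun i hi => ?_⟩
        rcases Nat.lt_succ_iff_lt_or_eq.1 hi with hi | rfl
        · exact h3 i hi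
        · rwa [h2] at hb
      · exact .inr ⟨h2, i, hi.trans (Nat.lt_succ_self n), hbi⟩

theorem normalize_spec (hgood : ∀ i s, P s → ¬ bad i s → step i s = s)
    (hbad : ∀ i s, P s → bad i s → P (step i s) ∧ size (step i s) < size s)
    (hsize : ∀ i s, bad i s → i < size s) {s : σ} (hs : P s) :
    P (normalize step size s) ∧ ∀ i, ¬ bad i (normalize step size s) := by
  -- Until no bad index is left, each pass lowers the size by at least one. After as many passes as
  -- the original size, either no bad index is left or the size is `0`, and then `hsize` excludes
  -- bad indices.
  have key : ∀ k, P (Nat.rec (motive := fun _ => σ) s (fun _ a => pass step (size a) a) k) ∧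
      ((∀ i, ¬ bad i (Nat.rec (motive := fun _ => σ) s (fun _ a => pass step (size a) a) k)) ∨
        size (Nat.rec (motive := fun _ => σ) s (fun _ a => pass step (size a) a) k) + k ≤
          size s) := by
    intro k
    induction k with
    | zero => exact ⟨hs, .inr le_rfl⟩
    | succ k ih =>
      simp only
      generalize Nat.rec (motive := fun _ => σ) s (fun _ a => pass step (size a) a) k = a at ih ⊢
      obtain ⟨h1, h2⟩ := ih
      obtain ⟨h3, h4⟩ := pass_spec hgood hbad (size a) h1
      refine ⟨h3, ?_⟩
      rcases h4 with ⟨h4, h5⟩ | ⟨h4, i, hi, hbi⟩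
      · left
        rw [h4]
        exact fun i hi => h5 i (hsize i a hi) hi
      · rcases h2 with h2 | h2
        · exact absurd hbi (h2 i)
        · right; omega
  obtain ⟨h1, h2⟩ := key (size s)
  refine ⟨h1, ?_⟩
  rcases h2 with h2 | h2
  · exact h2
  · intro i hi
    have := hsize i _ hi
    unfold normalize at this
    omega

end Normalize

/-- One step of the algorithm which joins components of a tagged phrase, where `E` tests phrases
for homotopy. -/
def stepCode (E : List (List (ℕ × ℕ)) × List (List (ℕ × ℕ)) → Bool) (i : ℕ)
    (s : List ℕ × List (List (ℕ × ℕ))) : List ℕ × List (List (ℕ × ℕ)) :=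
  bif decide (i + 1 < s.2.length ∧ ¬ s.1.getD (i + 1) 0 = 0) then
    bif decide (s.1.getD i 0 = s.1.getD (i + 1) 0) then (s.1.eraseIdx (i + 1), mergeAt i s.2)
    else bif E (s.2, eraseLettersAt (i + 1) s.2) then
      (s.1.eraseIdx (i + 1), mergeAt i (eraseLettersAt (i + 1) s.2))
    else s
  else s

theorem computable_stepCode {E : List (List (ℕ × ℕ)) × List (List (ℕ × ℕ)) → Bool}
    (hE : Computable E) : Computable₂ (stepCode E) := by
  have hi : Primrec fun x : ℕ × (List ℕ × List (List (ℕ × ℕ))) => x.1 := Primrec.fst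
  have hs : Primrec fun x : ℕ × (List ℕ × List (List (ℕ × ℕ))) => x.1 + 1 := Primrec.succ.comp hi
  have ht : Primrec fun x : ℕ × (List ℕ × List (List (ℕ × ℕ))) => x.2.1 :=
    Primrec.fst.comp Primrec.snd
  have hl : Primrec fun x : ℕ × (List ℕ × List (List (ℕ × ℕ))) => x.2.2 :=
    Primrec.snd.comp Primrec.snd
  have ht0 := (Primrec.list_getD 0).comp ht hi
  have ht1 := (Primrec.list_getD 0).comp ht hs
  have her := primrec_eraseLettersAt.comp hs hl
  have hix := primrec_eraseIdx.comp ht hs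
  refine Computable.cond (Primrec.to_comp ?_) (Computable.cond (Primrec.to_comp ?_)
    (Primrec.to_comp (Primrec.pair hix (primrec_mergeAt.comp hi hl)))
    (Computable.cond (hE.comp (Primrec.to_comp (Primrec.pair hl her)))
      (Primrec.to_comp (Primrec.pair hix (primrec_mergeAt.comp hi her))) Computable.snd))
    Computable.snd
  · exact PrimrecPred.decide (PrimrecPred.and (Primrec.nat_lt.comp hs (Primrec.list_length.comp hl))
      (PrimrecPred.not (Primrec.eq.comp ht1 (Primrec.const 0))))
  · exact PrimrecPred.decide (Primrec.eq.comp ht0 ht1)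

end Phrase

/-! ### Operations on codes agree with those on phrases -/

namespace Phrase

variable {α α' : Type*} {n n' : ℕ}

/-- The code of a phrase, for a given numbering of `α`. -/
def code (e : α ≃ Fin n) (l : Phrase α) : List (List (ℕ × ℕ)) :=
  l.map (List.map fun X => (X.1, (e X.2 : ℕ)))

theorem codeLetter_injective (e : α ≃ Fin n) :
    Function.Injective fun X : Letter α => (X.1, (e X.2 : ℕ)) := by
  rintro ⟨a, b⟩ ⟨c, d⟩ h
  simpa [Fin.val_inj] using h

theorem code_injective (e : α ≃ Fin n) : Function.Injective (code e) :=
  List.map_injective_iff.2 (List.map_injective_iff.2 (codeLetter_injective e))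

theorem length_code (e : α ≃ Fin n) (l : Phrase α) : (code e l).length = l.length := by
  simp [code]

theorem getD_code (e : α ≃ Fin n) (i : ℕ) (l : Phrase α) :
    (code e l).getD i [] = (l.getD i []).map fun X => (X.1, (e X.2 : ℕ)) := by
  simp only [code, List.getD_eq_getElem?_getD, List.getElem?_map]
  cases l[i]? <;> simp

theorem mergeAt_code (e : α ≃ Fin n) (i : ℕ) (l : Phrase α) :
    mergeAt i (code e l) = code e (mergeAt i l) :=
  mergeAt_map (fun _ _ => List.map_append) _ _

theorem eraseLettersAt_code (e : α ≃ Fin n) (i : ℕ) (l : Phrase α) :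
    eraseLettersAt i (code e l) = code e (eraseAt i l) := by
  classical
  rw [eraseLettersAt, getD_code]
  simp only [code, eraseAt, List.map_map]
  apply List.map_congr_left
  intro w _
  simp only [Function.comp, List.filter_map]
  congr 1
  apply List.filter_congr
  intro X _
  simp only [Function.comp, decide_eq_decide, not_iff_not]
  exact List.mem_map_of_injective (codeLetter_injective e)

/-- The table for `projCode` which belongs to `ι`. -/
noncomputable def projTable (ι : α' → α) (e : α ≃ Fin n) (e' : α' ≃ Fin n') : List (Option ℕ) :=
  List.ofFn fun k => (back ι (0, e.symm k)).map fun Y => (e' Y.2 : ℕ)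

theorem projCode_code (ι : α' → α) (e : α ≃ Fin n) (e' : α' ≃ Fin n') (l : Phrase α) :
    projCode (projTable ι e e') (code e l) = code e' (proj ι l) := by
  simp only [projCode, code, proj, List.map_map]
  apply List.map_congr_left
  intro w _
  simp only [Function.comp, List.filterMap_map, List.map_filterMap]
  apply List.filterMap_congr
  intro X _
  simp only [projTable, List.getD_eq_getElem?_getD, List.getElem?_ofFn, Fin.is_lt,
    dif_pos, Fin.eta, Equiv.symm_apply_apply, Option.getD_some, Option.map_map]
  -- The preimage chosen by `back` depends only on the projection of the letter, so the name `0`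
  -- used in the table is immaterial.
  unfold back
  split_ifs <;> simp

theorem refine_map_some (c : α → ℕ) (w : List (Letter α)) (T : List (Option (Letter α))) :
    tagged (refine c (w.map some ++ T)) =
      ((w.map fun X => c X.2) ++ (tagged (refine c T)).1,
        (w.map fun X => [X]) ++ (tagged (refine c T)).2) := by
  induction w with
  | nil => simp
  | cons X w ih =>
    have h := beginsWithBar_refine c (w.map some ++ T)
    simp only [tagged, Prod.mk.injEq] at ih
    obtain ⟨ih1, ih2⟩ := ih
    simp only [tagged, List.map_cons, List.cons_append, refine, marks, unmark_inl, unmark_inr,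
      parse, h, ih1, ih2]

theorem tagged_refine_lead (c : α → ℕ) (l : Phrase α) :
    tagged (refine c (lead l)) = (l.flatMap fun w => 0 :: w.map fun X => c X.2,
      l.flatMap fun w => [] :: w.map fun X => [X]) := by
  induction l with
  | nil => rfl
  | cons w l ih =>
    have h := beginsWithBar_refine c (w.map some ++ lead l)
    have h2 := refine_map_some c w (lead l)
    rw [ih] at h2
    simp only [tagged, Prod.mk.injEq] at h2
    simp only [lead, tagged, refine, marks, unmark_inl, parse, h, h2.1, h2.2, List.flatMap_cons,
      List.cons_append]

theorem refineCode_code (c : α → ℕ) (e : α ≃ Fin n) (l : Phrase α) :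
    refineCode (List.ofFn fun k => c (e.symm k)) (code e l) =
      ((tagged (refine c (lead l))).1, code e (tagged (refine c (lead l))).2) := by
  rw [tagged_refine_lead]
  simp [refineCode, code, List.flatMap_map, List.map_flatMap, List.getD_eq_getElem?_getD,
    List.getElem?_ofFn, Function.comp_def]

end Phrase

/-! ### Computing normal forms and deciding homotopy -/

namespace HomotopyDataTriple

open Phrase Relation

variable {α : Type*} {c : α → ℕ} {t : List ℕ} {l : Phrase α}

theorem Pure.refine (c : α → ℕ) (l : Phrase α) :
    Pure c (tagged (refine c (lead l))).1 (tagged (refine c (lead l))).2 := by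
  rw [tagged_refine_lead, Pure]
  induction l with
  | nil => simp
  | cons w l ih =>
    simp only [List.flatMap_cons]
    refine List.rel_append (List.Forall₂.cons (by simp) ?_) ih
    induction w with
    | nil => simp
    | cons X w ih => exact List.Forall₂.cons (by simp) ih

theorem Pure.eraseAt (h : Pure c t l) (i : ℕ) : Pure c t (eraseAt i l) := by
  rw [Pure, Phrase.eraseAt, List.forall₂_map_right_iff]
  exact h.imp fun n w hw X hX => hw X (List.mem_filter.1 hX).1

/-- The condition on the letters holds in both cases of a join: equal tags, or an absorbed component
which has been emptied. -/
theorem Pure.mergeAt (h : Pure c t l) {i : ℕ} (hi : i + 1 < l.length)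
    (hd : ∀ X ∈ l.getD (i + 1) [], c X.2 = t.getD i 0) :
    Pure c (t.eraseIdx (i + 1)) (mergeAt i l) := by
  unfold Pure at h ⊢
  induction h generalizing i with
  | nil => simp at hi
  | @cons n w t l hw h ih =>
    cases i with
    | zero =>
      cases h with
      | nil => simp at hi
      | @cons m v t l hv h =>
        refine List.Forall₂.cons ?_ h
        intro X hX
        rcases List.mem_append.1 hX with hX | hX
        · exact hw X hX
        · simpa using hd X (by simpa using hX)
    | succ i =>
      exact List.Forall₂.cons hw (ih (by simpa using hi) (by simpa using hd))

theorem Pure.tag_eq (h : Pure c t l) {i : ℕ} {X : Letter α} (hX : X ∈ l.getD i []) :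
    c X.2 = t.getD i 0 := by
  unfold Pure at h
  induction h generalizing i with
  | nil => simp at hX
  | cons hw _ ih =>
    cases i with
    | zero => exact hw X (by simpa using hX)
    | succ i => exact ih (by simpa using hX)

variable {H : HomotopyDataTriple α}

/-- Purity makes the tag list as long as the phrase, so the default values are never read in the
relevant range. -/
theorem canMerge_iff (h : Pure c t l) {i : ℕ} :
    H.CanMerge i (t, l) ↔ (i + 1 < l.length ∧ ¬ t.getD (i + 1) 0 = 0) ∧
      (t.getD i 0 = t.getD (i + 1) 0 ∨ H.PhraseHomotopic l (eraseAt (i + 1) l)) := by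
  have hlen := h.length_eq
  constructor
  · rintro ⟨hi, d, hd, h1, h2⟩
    refine ⟨⟨hi, by simpa [List.getD_eq_getElem?_getD, h1] using hd⟩, h2.imp_left fun h2 => ?_⟩
    simp only at h1 h2
    simp [List.getD_eq_getElem?_getD, h1, h2]
  · rintro ⟨⟨hi, h1⟩, h2⟩
    have hi' : i + 1 < t.length := hlen ▸ hi
    refine ⟨hi, t.getD (i + 1) 0, h1, ?_, h2.imp_left fun h2 => ?_⟩
    · simp [List.getD_eq_getElem?_getD, List.getElem?_eq_getElem hi']
    · rw [← h2]
      simp [List.getD_eq_getElem?_getD, List.getElem?_eq_getElem (show i < t.length by omega)]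

/-- The algorithm computes a normal form. -/
theorem exists_normal_form {n : ℕ} (e : α ≃ Fin n)
    {E : List (List (ℕ × ℕ)) × List (List (ℕ × ℕ)) → Bool}
    (hE : ∀ (t : List ℕ) (l l' : Phrase α), Gauss l → Gauss l' → Pure c t l → Pure c t l' →
      (E (code e l, code e l') = true ↔ H.PhraseHomotopic l l'))
    {a : List ℕ × Phrase α} (ha : Gauss a.2) (hp : Pure c a.1 a.2) :
    ∃ b : List ℕ × Phrase α, Gauss b.2 ∧ Pure c b.1 b.2 ∧ H.IsNormal b ∧
      EqvGen H.Rewrites a b ∧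
      normalize (stepCode E) (fun s => s.2.length) (a.1, code e a.2) = (b.1, code e b.2) := by
  -- Invariant of the algorithm: the state codes a pure Gauss phrase equivalent to `a`. Purity is
  -- needed because `E` is reliable only on pure phrases with common tags.
  let P : List ℕ × List (List (ℕ × ℕ)) → Prop := fun s => ∃ b : List ℕ × Phrase α,
    Gauss b.2 ∧ Pure c b.1 b.2 ∧ EqvGen H.Rewrites a b ∧ s = (b.1, code e b.2)
  let bad : ℕ → List ℕ × List (List (ℕ × ℕ)) → Prop := fun i s =>
    ∃ b : List ℕ × Phrase α, s = (b.1, code e b.2) ∧ H.CanMerge i b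
  have hinj : ∀ {b b' : List ℕ × Phrase α}, (b.1, code e b.2) = (b'.1, code e b'.2) → b = b' := by
    intro b b' h
    simp only [Prod.mk.injEq] at h
    exact Prod.ext h.1 (code_injective e h.2)
  have hgood : ∀ i s, P s → ¬ bad i s → stepCode E i s = s := by
    rintro i _ ⟨⟨t, l⟩, hg, hpb, -, rfl⟩ hbad
    have hno : ¬ H.CanMerge i (t, l) := fun h => hbad ⟨(t, l), rfl, h⟩
    rw [canMerge_iff hpb] at hno
    simp only [stepCode, length_code, eraseLettersAt_code]
    by_cases h1 : i + 1 < l.length ∧ ¬ t.getD (i + 1) 0 = 0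
    · replace hno := not_or.1 fun h => hno ⟨h1, h⟩
      have h3 : E (code e l, code e (eraseAt (i + 1) l)) = false := by
        rw [Bool.eq_false_iff, ne_eq, hE t _ _ hg (hg.eraseAt _) hpb (hpb.eraseAt _)]
        exact hno.2
      rw [decide_eq_false hno.1, h3]
      simp
    · rw [decide_eq_false h1]; rfl
  have hbad : ∀ i s, P s → bad i s → P (stepCode E i s) ∧ (stepCode E i s).2.length < s.2.length := by
    rintro i _ ⟨⟨t, l⟩, hg, hpb, hab, rfl⟩ ⟨b, hb, hm⟩
    obtain rfl := hinj hb
    have hm' := hm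
    rw [canMerge_iff hpb] at hm'
    obtain ⟨h1, h2⟩ := hm'
    have hl : (mergeAt i l).length + 1 = l.length := length_mergeAt h1.1
    simp only at hg hpb
    simp only [stepCode, length_code, eraseLettersAt_code]
    rw [decide_eq_true h1, cond_true]
    by_cases h3 : t.getD i 0 = t.getD (i + 1) 0
    · rw [decide_eq_true h3, cond_true]
      refine ⟨⟨(t.eraseIdx (i + 1), mergeAt i l), hg.mergeAt i,
        hpb.mergeAt h1.1 fun X hX => by rw [h3]; exact hpb.tag_eq hX,
        .trans _ _ _ hab (.rel _ _ (.inr ⟨i, hm, rfl, .refl (hg.mergeAt i)⟩)),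
        by rw [mergeAt_code]⟩, ?_⟩
      simp only [mergeAt_code, length_code]
      omega
    · have h4 := h2.resolve_left h3
      rw [decide_eq_false h3, cond_false,
        (hE t _ _ hg (hg.eraseAt _) hpb (hpb.eraseAt _)).2 h4, cond_true]
      have hl' := length_mergeAt (l := eraseAt (i + 1) l) (by rw [length_eraseAt]; exact h1.1)
      rw [length_eraseAt] at hl'
      -- With different tags, joining directly could mix colours. The component is emptied before it
      -- is joined, and by `h4` this gives a homotopic result.
      refine ⟨⟨(t.eraseIdx (i + 1), mergeAt i (eraseAt (i + 1) l)), (hg.eraseAt _).mergeAt i,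
        (hpb.eraseAt _).mergeAt (by rw [length_eraseAt]; exact h1.1)
          fun X hX => by rw [getD_eraseAt_self] at hX; simp at hX,
        .trans _ _ _ hab (.rel _ _ (.inr ⟨i, hm, rfl, h4.mergeAt i⟩)),
        by rw [mergeAt_code]⟩, ?_⟩
      simp only [mergeAt_code, length_code]
      omega
  have hsize : ∀ i s, bad i s → i < s.2.length := by
    rintro i _ ⟨b, rfl, hm⟩
    simp only [length_code]
    exact (Nat.lt_succ_self i).trans hm.1
  obtain ⟨⟨b, hg, hpb, hab, hs⟩, hn⟩ := normalize_spec (size := fun s => s.2.length) hgood hbad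
    hsize (s := (a.1, code e a.2)) ⟨a, ha, hp, .refl a, rfl⟩
  exact ⟨b, hg, hpb, fun i hi => hn i ⟨b, hs, hi⟩, hab, hs⟩

/-- Compute both normal forms and compare their tags; if these agree, the phrases are pure with
common tags and the given test applies. -/
theorem equalityDecidable_of_pure [Finite α] (hc : H.IsColouring c)
    (hE : ∀ {n : ℕ} (e : α ≃ Fin n), ∃ E : List (List (ℕ × ℕ)) × List (List (ℕ × ℕ)) → Bool,
      Computable E ∧ ∀ (t : List ℕ) (l l' : Phrase α), Gauss l → Gauss l' → Pure c t l →
        Pure c t l' → (E (code e l, code e l') = true ↔ H.PhraseHomotopic l l')) :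
    H.EqualityDecidable := by
  obtain ⟨n, ⟨e⟩⟩ := Finite.exists_equiv_fin α
  obtain ⟨E, hEc, hE⟩ := hE e
  obtain ⟨F, hF, key⟩ : ∃ F : List (List (ℕ × ℕ)) → List ℕ × List (List (ℕ × ℕ)),
      Computable F ∧ ∀ p : Nanophrase α, ∃ b : List ℕ × Phrase α, Gauss b.2 ∧ Pure c b.1 b.2 ∧
        H.IsNormal b ∧ EqvGen H.Rewrites (tagged (Phrase.refine c (lead p.components))) b ∧
        F (p.code e) = (b.1, code e b.2) := by
    refine ⟨_, (computable_normalize (computable_stepCode hEc)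
      (Primrec.to_comp (Primrec.list_length.comp Primrec.snd))).comp
      (Primrec.to_comp (primrec_refineCode (List.ofFn fun k => c (e.symm k)))), fun p => ?_⟩
    have := exists_normal_form e hE ((gauss_refine (l := p.components) c).2 p.gauss) (.refine c _)
    rw [← refineCode_code] at this
    exact this
  have hF1 := hF.comp (Computable.fst (α := List (List (ℕ × ℕ))) (β := List (List (ℕ × ℕ))))
  have hF2 := hF.comp (Computable.snd (α := List (List (ℕ × ℕ))) (β := List (List (ℕ × ℕ))))
  have hdec : Computable fun x : List ℕ × List ℕ => decide (x.1 = x.2) :=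
    Primrec.to_comp (PrimrecPred.decide (Primrec.eq.comp Primrec.fst Primrec.snd))
  refine ⟨n, e, fun x => bif decide ((F x.1).1 = (F x.2).1) then E ((F x.1).2, (F x.2).2) else
    false, ?_, fun p q => ?_⟩
  · exact Computable.cond
      (hdec.comp (Computable.pair (Computable.fst.comp hF1) (Computable.fst.comp hF2)))
      (hEc.comp (Computable.pair (Computable.snd.comp hF1) (Computable.snd.comp hF2)))
      (Computable.const false)
  · obtain ⟨b, hg, hp, hn, hb, e1⟩ := key p
    obtain ⟨b', hg', hp', hn', hb', e2⟩ := key q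
    rw [← Nanophrase.phraseHomotopic_iff, phraseHomotopic_iff_eqvGen hc p.gauss]
    simp only [e1, e2]
    have : EqvGen H.Rewrites (tagged (Phrase.refine c (lead p.components)))
        (tagged (Phrase.refine c (lead q.components))) ↔ b.1 = b'.1 ∧ H.PhraseHomotopic b.2 b'.2 :=
      ⟨fun h => hn.eq_of_eqvGen hn' hg hg' (.trans _ _ _ (.symm _ _ hb) (.trans _ _ _ h hb')),
        fun h => .trans _ _ _ hb (.trans _ _ _ (.rel _ _ (.inl h)) (.symm _ _ hb'))⟩
    rw [this]
    by_cases h : b.1 = b'.1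
    · rw [decide_eq_true h, cond_true, hE b.1 _ _ hg hg' hp (h ▸ hp')]
      simp [h]
    · simp [h]

/-- If a triple is composed of two factors with decidable homotopy of nanophrases, then its own
homotopy of nanophrases is decidable. -/
theorem EqualityDecidable.of_isFactorMap [Finite α] {α₁ α₂ : Type*} {H₁ : HomotopyDataTriple α₁}
    {H₂ : HomotopyDataTriple α₂} {ι₁ : α₁ → α} {ι₂ : α₂ → α} (h₁ : IsFactorMap H₁ H ι₁)
    (h₂ : IsFactorMap H₂ H ι₂) (hr : ∀ a, a ∈ Set.range ι₁ ↔ a ∉ Set.range ι₂)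
    (d₁ : H₁.EqualityDecidable) (d₂ : H₂.EqualityDecidable) : H.EqualityDecidable := by
  classical
  obtain ⟨n₁, e₁, f₁, hf₁, d₁⟩ := d₁
  obtain ⟨n₂, e₂, f₂, hf₂, d₂⟩ := d₂
  -- The colours are `1` and `2`, as `0` is reserved for original bars.
  let c : α → ℕ := fun a => if a ∈ Set.range ι₁ then 1 else 2
  have hcc : ∀ a b, c a = c b ↔ (a ∈ Set.range ι₁ ↔ b ∈ Set.range ι₁) := by
    intro a b
    by_cases ha : a ∈ Set.range ι₁ <;> by_cases hb : b ∈ Set.range ι₁ <;> simp only [c, ha, hb] <;>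
      simp
  refine equalityDecidable_of_pure (c := c) ⟨fun a => ?_, fun a => ?_, fun x y z h => ?_⟩ ?_
  · simp only [c]; split_ifs <;> simp
  · rw [hcc]
    constructor
    · rintro ⟨b, hb⟩
      exact ⟨H₁.τ b, by rw [h₁.map_τ, hb, H.involutive]⟩
    · rintro ⟨b, rfl⟩
      exact ⟨H₁.τ b, h₁.map_τ b⟩
  · rw [hcc, hcc]
    rcases h₁.dichotomy _ _ _ h with ⟨hx, hy, hz⟩ | ⟨hx, hy, hz⟩ <;> simp [hx, hy, hz]
  · intro n e
    refine ⟨fun x => bif f₁ (projCode (projTable ι₁ e e₁) x.1, projCode (projTable ι₁ e e₁) x.2) then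
      f₂ (projCode (projTable ι₂ e e₂) x.1, projCode (projTable ι₂ e e₂) x.2) else false,
      Computable.cond (hf₁.comp ?_) (hf₂.comp ?_) (Computable.const false), ?_⟩
    · exact Primrec.to_comp (Primrec.pair ((primrec_projCode _).comp Primrec.fst)
        ((primrec_projCode _).comp Primrec.snd))
    · exact Primrec.to_comp (Primrec.pair ((primrec_projCode _).comp Primrec.fst)
        ((primrec_projCode _).comp Primrec.snd))
    · intro t l l' hl hl' hp hp'
      rw [phraseHomotopic_iff_of_pure h₁ h₂ hr (fun a b => (hcc a b).1) hl hl' hp hp']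
      simp only [projCode_code]
      have k₁ := d₁ ⟨proj ι₁ l, hl.proj h₁.inj⟩ ⟨proj ι₁ l', hl'.proj h₁.inj⟩
      have k₂ := d₂ ⟨proj ι₂ l, hl.proj h₂.inj⟩ ⟨proj ι₂ l', hl'.proj h₂.inj⟩
      rw [← Nanophrase.phraseHomotopic_iff] at k₁ k₂
      simp only at k₁ k₂
      rw [← k₁, ← k₂]
      simp only [Nanophrase.code, code, Bool.cond_false_right, Bool.and_eq_true]

/-- If `p` is homotopic to `q` with empty component `i`, then `eraseAt i` fixes `q`, so its homotopy
invariance makes the erased `p` homotopic to `q` and hence to `p`. -/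
theorem isReducibleAt_iff (p : Nanophrase α) (i : ℕ) :
    H.IsReducibleAt p i ↔ i < p.components.length ∧
      H.PhraseHomotopic p.components (eraseAt i p.components) := by
  constructor
  · rintro ⟨q, h, hq⟩
    rw [← Nanophrase.phraseHomotopic_iff] at h
    refine ⟨?_, ?_⟩
    · rw [h.length_eq]
      exact (List.getElem?_eq_some_iff.1 hq).1
    · have e : eraseAt i q.components = q.components :=
        eraseAt_eq_self (by simp [List.getD_eq_getElem?_getD, hq])
      exact h.trans (e ▸ (h.eraseAt i).symm)
  · rintro ⟨hi, _, hg, h⟩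
    refine ⟨⟨_, hg⟩, h, ?_⟩
    have hi' : i < (eraseAt i p.components).length := by rwa [length_eraseAt]
    have := getD_eraseAt_self i p.components
    rw [List.getD_eq_getElem?_getD] at this
    simp only [List.getElem?_eq_getElem hi', Option.getD_some] at this ⊢
    rw [this]

/-- Reducibility can be decided if homotopy can. -/
theorem EqualityDecidable.reductionDecidable (h : H.EqualityDecidable) : H.ReductionDecidable := by
  obtain ⟨n, e, f, hf, h⟩ := h
  refine ⟨n, e, fun x => bif decide (x.2 < x.1.length) then f (x.1, eraseLettersAt x.2 x.1)
    else false, Computable.cond (Primrec.to_comp ?_) (hf.comp (Primrec.to_comp ?_))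
    (Computable.const false), fun p i => ?_⟩
  · exact PrimrecPred.decide (Primrec.nat_lt.comp Primrec.snd
      (Primrec.list_length.comp Primrec.fst))
  · exact Primrec.pair Primrec.fst (primrec_eraseLettersAt.comp Primrec.snd Primrec.fst)
  · rw [isReducibleAt_iff]
    have k := h p ⟨_, Gauss.eraseAt i p.gauss⟩
    rw [← Nanophrase.phraseHomotopic_iff] at k
    rw [← k]
    have e1 : p.code e = code e p.components := rfl
    simp only [e1, eraseLettersAt_code, length_code]
    simp [Nanophrase.code, code]

end HomotopyDataTriple

/-! ### Induction over factors -/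

namespace HomotopyDataTriple

universe u

variable {α : Type u} {H : HomotopyDataTriple α}

theorem IsFactor.dichotomy {β : Set α} (h : H.IsFactor β) {a b c : α} (hS : (a, b, c) ∈ H.S) :
    (a ∈ β ∧ b ∈ β ∧ c ∈ β) ∨ (a ∉ β ∧ b ∉ β ∧ c ∉ β) := by
  rw [h.S_eq] at hS
  rcases hS with ⟨-, h⟩ | ⟨-, h⟩
  · exact .inl h
  · exact .inr h

theorem IsFactor.of_dichotomy {β : Set α} (hτ : Set.MapsTo H.τ β β)
    (h : ∀ a b c, (a, b, c) ∈ H.S → (a ∈ β ∧ b ∈ β ∧ c ∈ β) ∨ (a ∉ β ∧ b ∉ β ∧ c ∉ β)) :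
    H.IsFactor β := by
  refine ⟨hτ, Set.Subset.antisymm ?_ (by simp)⟩
  rintro ⟨a, b, c⟩ hS
  rcases h a b c hS with h | h
  · exact .inl ⟨hS, h⟩
  · exact .inr ⟨hS, h⟩

theorem IsFactor.compl {β : Set α} (h : H.IsFactor β) : H.IsFactor βᶜ := by
  refine .of_dichotomy (fun a ha hb => ha ?_) fun a b c hS => ?_
  · rw [← H.involutive a]; exact h.mapsTo hb
  · simpa only [Set.mem_compl_iff, not_not] using (h.dichotomy hS).symm

theorem IsFactor.isFactorMap {β : Set α} (h : H.IsFactor β) :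
    IsFactorMap (H.restrict β h.mapsTo) H Subtype.val where
  inj := Subtype.val_injective
  map_τ _ := rfl
  mem_S _ _ _ := Iff.rfl
  dichotomy a b c hS := by simpa using h.dichotomy hS

/-- A factor of a factor is a factor. -/
theorem IsFactor.image {β : Set α} (h : H.IsFactor β) {δ : Set β}
    (hδ : (H.restrict β h.mapsTo).IsFactor δ) : H.IsFactor (Subtype.val '' δ) := by
  refine .of_dichotomy ?_ fun a b c hS => ?_
  · rintro _ ⟨a, ha, rfl⟩
    exact ⟨_, hδ.mapsTo ha, rfl⟩
  · rcases h.dichotomy hS with ⟨ha, hb, hc⟩ | ⟨ha, hb, hc⟩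
    · have := hδ.dichotomy (a := ⟨a, ha⟩) (b := ⟨b, hb⟩) (c := ⟨c, hc⟩) hS
      simpa [ha, hb, hc] using this
    · right
      simp [ha, hb, hc]

/-- The inclusion of a factor contained in another factor. -/
theorem IsFactor.isFactorMap_inclusion {β β' : Set α} (h : H.IsFactor β) (h' : H.IsFactor β')
    (hβ : β' ⊆ β) : IsFactorMap (H.restrict β' h'.mapsTo) (H.restrict β h.mapsTo)
      (Set.inclusion hβ) where
  inj := Set.inclusion_injective hβ
  map_τ _ := rfl
  mem_S _ _ _ := Iff.rfl
  dichotomy a b c hS := by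
    simpa [Set.range_inclusion] using h'.dichotomy (H := H) hS

/-- A non-empty factor that is not prime splits into two smaller non-empty factors. Their images in
`α` are factors of `H` itself, so strong induction on the cardinality applies. -/
theorem IsFactor.equalityDecidable [Finite α]
    (hprime : ∀ (β : Set α) (hβ : H.IsFactor β), (H.restrict β hβ.mapsTo).IsPrime →
      (H.restrict β hβ.mapsTo).EqualityDecidable) (β : Set α) (hβ : H.IsFactor β)
    (hne : β.Nonempty) : (H.restrict β hβ.mapsTo).EqualityDecidable := by
  induction hn : β.ncard using Nat.strong_induction_on generalizing β with
  | _ n ih =>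
    by_cases hp : (H.restrict β hβ.mapsTo).IsPrime
    · exact hprime β hβ hp
    · have : ∃ δ : Set β, (H.restrict β hβ.mapsTo).IsProperFactor δ := by
        by_contra hno
        exact hp ⟨hne.to_subtype, hno⟩
      obtain ⟨δ, hδ, hδne, hδu⟩ := this
      have hδc : δᶜ.Nonempty := Set.nonempty_compl.2 hδu
      -- Stated for both `δ` and its complement; a point outside `δ` makes the image strictly
      -- smaller than `β`.
      have step : ∀ δ : Set β, (H.restrict β hβ.mapsTo).IsFactor δ → δ.Nonempty → δᶜ.Nonempty →
          ∃ h : H.IsFactor (Subtype.val '' δ),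
            (H.restrict (Subtype.val '' δ) h.mapsTo).EqualityDecidable := by
        intro δ hδ hδne hδc
        refine ⟨hβ.image hδ, ih _ ?_ _ (hβ.image hδ) (hδne.image _) rfl⟩
        rw [← hn]
        refine Set.ncard_lt_ncard ⟨Subtype.coe_image_subset β δ, fun hsub => ?_⟩ (Set.toFinite β)
        obtain ⟨a, ha⟩ := hδc
        obtain ⟨b, hb, hba⟩ := hsub a.2
        exact ha (Subtype.ext hba ▸ hb)
      obtain ⟨h₁, d₁⟩ := step δ hδ hδne hδc
      obtain ⟨h₂, d₂⟩ := step δᶜ hδ.compl hδc (by rwa [compl_compl])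
      refine EqualityDecidable.of_isFactorMap
        (hβ.isFactorMap_inclusion h₁ (Subtype.coe_image_subset β δ))
        (hβ.isFactorMap_inclusion h₂ (Subtype.coe_image_subset β δᶜ)) (fun a => ?_) d₁ d₂
      simp [Set.range_inclusion]

end HomotopyDataTriple

theorem mainTheorem6 {α : Type*} [Finite α] (H : HomotopyDataTriple α)
    (hcomp : H.IsComposite)
    (hprime : ∀ (β : Set α) (hβ : H.IsFactor β), (H.restrict β hβ.mapsTo).IsPrime →
      (H.restrict β hβ.mapsTo).ReductionDecidable ∧
      (H.restrict β hβ.mapsTo).EqualityDecidable) :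
    H.ReductionDecidable ∧ H.EqualityDecidable := by
  obtain ⟨β, hβ, hne, hu⟩ := hcomp
  have hdec := HomotopyDataTriple.IsFactor.equalityDecidable fun β hβ hp => (hprime β hβ hp).2
  have h := HomotopyDataTriple.EqualityDecidable.of_isFactorMap hβ.isFactorMap
    hβ.compl.isFactorMap (fun a => by simp) (hdec β hβ hne)
    (hdec βᶜ hβ.compl (Set.nonempty_compl.2 hu))
  exact ⟨h.reductionDecidable, h⟩
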